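/- **Conventions.** All locales are identified with their frames; a map of locales $f:X\to Y$ has an inverse image frame homomorphism $f^*:Y\to X$. It is *open* if $f^*$ has a left adjoint $f_!$ with $f_!(x\wedge f^*(y))=f_!(x)\wedge y$, and *surjective* if $f^*$ is injective. A *localic groupoid* $G$ is an internal groupoid in locales with domain, range, unit, inversion and multiplication maps $d,r:G_1\to G_0$, $u:G_0\to G_1$, $i:G_1\to G_1$, $m:G_2\to G_1$, where $G_2$ is the pullback of $r$ and $d$; it is *open* if $d$ is open. A *(left) $G$-locale* is a locale $X$ with maps $p:X\to G_0$ and $\mathfrak a:G_1\times_{G_0}X\to X$ (pullback of $r$ and $p$) such that $p\circ\mathfrak a=d\circ\pi_1$, and $\mathfrak a$ is associative and unitary. A *principal $G$-bundle over $M$* is a $G$-locale with an open surjection $\pi:X\to M$ such that $\pi\circ\mathfrak a=\pi\circ\pi_2$ and the pairing map $\langle\mathfrak a,\pi_2\rangle:G_1\times_{G_0}X\to X\times_MX$ is an isomorphism; its inverse is written $\langle\theta,\pi_2\rangle$ with $\theta:X\times_MX\to G_1$. It is *fully open* if $p$ is an open surjection. In a pullback, $x\otimes y$ denotes $\pi_1^*(x)\wedge\pi_2^*(y)$;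 tensor products of modules over locales are taken in sup-lattices. **The quantale $\mathcal O(G)$.** For $G$ open, $Q=\mathcal O(G)$ is the frame $G_1$ with base locale $A=G_0$, multiplication $xy=m_!(x\otimes y)$, involution $x^*=i_!(x)$, actions ${}_{a|}q=d^*(a)\wedge q$ and $q_{|a}=q\wedge r^*(a)$, support $\varsigma_Q=d_!$ and $\upsilon=u^*$. **Groupoid quantales.** A *groupoid quantale* $Q$ with base locale $A$ is a frame that is an involutive $A$-$A$-quantale (multiplication and the two unital $A$-actions preserve joins in each variable, multiplication is associative, ${}_{a|}(q_{|b})=({}_{a|}q)_{|b}$, $({}_{a|}x)y={}_{a|}(xy)$, $(x_{|a})y=x({}_{a|}y)$, $(xy)_{|a}=x(y_{|a})$, the involution preserves joins, reverses products, and $({}_{a|}x_{|b})^*={}_{b|}x^*{}_{|a}$), with $({}_{a|}q)\wedge m={}_{a|}(q\wedge m)$ and $m\wedge(q_{|a})=(q\wedge m)_{|a}$; equipped with a join-preserving $\varsigma_Q:Q\to A$ such that $\varsigma_Q(1)=1$, ${}_{\varsigma_Q(x)|}y\le xx^*y$, ${}_{\varsigma_Q(x)|}x=x$, $\varsigma_Q({}_{a|}x)=a\wedge\varsigma_Q(x)$,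 and a frame homomorphism $\upsilon:Q\to A$ with $\upsilon({}_{a|}1)=a=\upsilon(1_{|a})$; such that the right adjoint of the multiplication $Q\otimes_AQ\to Q$ preserves joins, $\bigvee_{xy\le a}{}_{\upsilon(x)|}y=a$, and ${}_{\upsilon(a)|}1=\bigvee_{xx^*\le a}x$. **Principal $Q$-locales.** Let $Q$ be a groupoid quantale. A *principal $Q$-locale over $M$* is a locale $X$ with a $Q$-action $q\cdot x$ and a unital $A$-action ${}_{a|}x$ (both join-preserving in each variable and associative), an inner product $\langle-,-\rangle:X\times X\to Q$, a monotone support $\varsigma_X:X\to A$, and a map of locales $\pi:X\to M$, such that 1. ($Q$-module) $({}_{a|}q)\cdot x={}_{a|}(q\cdot x)$, $(q_{|a})\cdot x=q\cdot({}_{a|}x)$, ${}_{a|}(x\wedge y)=({}_{a|}x)\wedge y$; 2. (pre-Hilbert) $\langle q\cdot x,y\rangle=q\langle x,y\rangle$, ${}_{a|}\langle x,1\rangle=\langle{}_{a|}x,1\rangle$, $\langle\bigvee_kx_k,y\rangle=\bigvee_k\langle x_k,y\rangle$, $\langle x,y\rangle=\langle y,x\rangle^*$; 3. (stable support) $\varsigma_X(1)=1$,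 ${}_{\varsigma_X(x)|}1\le\langle x,x\rangle\cdot1$, ${}_{\varsigma_X(x)|}x=x$, $\varsigma_X(q\cdot x)\le\varsigma_Q(q)$; 4. (Q1) $\alpha_*:X\to Q\otimes_AX$, $\alpha_*(x)=\bigvee_{q\cdot y\le x}q\otimes y$, preserves joins; (Q2) $\bigvee_{q\cdot y\le x}{}_{\upsilon(q)|}y=x$ for all $x$; 5. (P1) $\pi$ is open and $\pi_!(1_X)=1_M$; (P2) $\pi_!(q\cdot x)=\pi_!({}_{\varsigma_Q(q^*)|}x)$; (P3) there is a frame isomorphism $\varphi:X\otimes_MX\to Q\otimes_AX$ with $\varphi(x\otimes y)=\bigvee_{q\cdot z\le x}q\otimes(z\wedge y)$. **Theorem.** Let $G$ be an open localic groupoid, $M$ a locale, and $(X,p,\mathfrak a,\pi)$ a fully open principal $G$-bundle over $M$. Then $\mathcal O(G)$ is a groupoid quantale, and $X$, with $$q\cdot x=\mathfrak a_!(q\otimes x),\qquad {}_{a|}x=p^*(a)\wedge x,\qquad \langle x,y\rangle=\theta_!(x\otimes y),\qquad \varsigma_X=p_!,$$ and the map $\pi:X\to M$, is a principal $\mathcal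 O(G)$-locale over $M$. -/

import Mathlib

open CategoryTheory

universe u

/-! ### Maps of locales: direct images, openness, surjectivity -/

section Frames

variable {X Y : Type*} [Order.Frame X] [Order.Frame Y]

/-- The candidate for the left adjoint `f_!` of an inverse image homomorphism `f^* : Y → X`,
given by `f_!(x) = ⋀ {y | x ≤ f^*(y)}`. It is the left adjoint whenever one exists. -/
def directIm (φ : FrameHom Y X) (x : X) : Y := sInf {y | x ≤ φ y}

/-- `φ = f^*` is the inverse image homomorphism of an open map of locales: it has a left adjoint
`f_!`, and the Frobenius condition `f_!(x ∧ f^*(y)) = f_!(x) ∧ y` holds. -/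
structure IsOpenFrameHom (φ : FrameHom Y X) : Prop where
  gc : GaloisConnection (directIm φ) φ
  frobenius : ∀ (x : X) (y : Y), directIm φ (x ⊓ φ y) = directIm φ x ⊓ y

end Frames

/-- The inverse image homomorphism `f^*` of a map of locales `f`. -/
abbrev invIm {X Y : Locale.{u}} (f : X ⟶ Y) : FrameHom Y.unop X.unop := f.unop.hom

/-- The direct image `f_!` of an open map of locales `f`. -/
abbrev dirIm {X Y : Locale.{u}} (f : X ⟶ Y) : X.unop → Y.unop := directIm (invIm f)

/-- Open maps of locales. -/
def IsOpenLocaleMap {X Y : Locale.{u}} (f : X ⟶ Y) : Prop := IsOpenFrameHom (invIm f)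

/-- Surjections of locales: the inverse image homomorphism is injective. -/
def IsSurjLocaleMap {X Y : Locale.{u}} (f : X ⟶ Y) : Prop := Function.Injective (invIm f)

/-! ### Balanced tensor products of sup-lattices -/

/-- The tensor product `Q ⊗_A X` in the category of sup-lattices, where `A` acts on `Q` on the
right by `(q, a) ↦ ρ q a` and on `X` on the left by `(a, x) ↦ l a x`. As usual it is realized by
the sets of pairs that are down-closed, closed under joins in each of the two variables, and
balanced over `A`. -/
@[ext]
structure SupTensor {A Q X : Type*} [CompleteLattice Q] [CompleteLattice X]
    (ρ : Q → A → Q) (l : A → X → X) where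
  carrier : Set (Q × X)
  down : ∀ q q' x x', q' ≤ q → x' ≤ x → (q, x) ∈ carrier → (q', x') ∈ carrier
  sup_left : ∀ (S : Set Q) (x : X), (∀ q ∈ S, (q, x) ∈ carrier) → (sSup S, x) ∈ carrier
  sup_right : ∀ (q : Q) (S : Set X), (∀ x ∈ S, (q, x) ∈ carrier) → (q, sSup S) ∈ carrier
  balanced : ∀ (q : Q) (a : A) (x : X), (ρ q a, x) ∈ carrier ↔ (q, l a x) ∈ carrier

namespace SupTensor

variable {A Q X : Type*} [CompleteLattice Q] [CompleteLattice X] {ρ : Q → A → Q} {l : A → X → X}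

instance : PartialOrder (SupTensor ρ l) :=
  PartialOrder.lift SupTensor.carrier (fun _ _ h => SupTensor.ext h)

instance : InfSet (SupTensor ρ l) where
  sInf T :=
    { carrier := {p | ∀ t ∈ T, p ∈ t.carrier}
      down := fun _ _ _ _ hq hx h t ht => t.down _ _ _ _ hq hx (h t ht)
      sup_left := fun _ _ h t ht => t.sup_left _ _ (fun q hq => h q hq t ht)
      sup_right := fun _ _ h t ht => t.sup_right _ _ (fun x hx => h x hx t ht)
      balanced := fun q a x =>
        ⟨fun h t ht => (t.balanced q a x).1 (h t ht), fun h t ht => (t.balanced q a x).2 (h t ht)⟩ }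

instance : CompleteLattice (SupTensor ρ l) :=
  completeLatticeOfInf _ (fun _ =>
    ⟨fun t ht _ hp => hp t ht, fun _ hs p hp _ ht => hs ht hp⟩)

variable (ρ l) in
/-- The pure tensor `q ⊗ x`. -/
def tmul (q : Q) (x : X) : SupTensor ρ l := sInf {t | (q, x) ∈ t.carrier}

/-- The sup-lattice homomorphism on `Q ⊗_A X` induced by a balanced map `f` that preserves joins
in each variable; on pure tensors it is `q ⊗ x ↦ f q x`. -/
def lift {Z : Type*} [CompleteLattice Z] (f : Q → X → Z) (t : SupTensor ρ l) : Z :=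
  ⨆ p ∈ t.carrier, f p.1 p.2

end SupTensor

/-! ### Groupoid quantales -/

/-- The operations of a based quantale `Q` with base locale `A`, with a support and a map `υ`:
the actions `a|q` (`lres`) and `q|a` (`rres`), multiplication, involution, support and
reflexivity homomorphism. The laws are in the predicates below. -/
structure QuantaleOps (A Q : Type*) [Order.Frame A] [Order.Frame Q] where
  lres : A → Q → Q
  rres : Q → A → Q
  mul : Q → Q → Q
  star : Q → Q
  supp : Q → A
  ups : FrameHom Q A

namespace QuantaleOps

variable {A Q : Type*} [Order.Frame A] [Order.Frame Q]

/-- `Q` is an `A`-`A`-bimodule: a sup-lattice with commuting unital left and right actions of the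
locale `A`, regarded as the quantale `(A, ∧)`. -/
structure IsBimodule (D : QuantaleOps A Q) : Prop where
  lres_sSup_left : ∀ (S : Set A) (q : Q), D.lres (sSup S) q = ⨆ a ∈ S, D.lres a q
  lres_sSup_right : ∀ (a : A) (S : Set Q), D.lres a (sSup S) = ⨆ q ∈ S, D.lres a q
  lres_inf : ∀ (a b : A) (q : Q), D.lres (a ⊓ b) q = D.lres a (D.lres b q)
  lres_top : ∀ q : Q, D.lres ⊤ q = q
  rres_sSup_left : ∀ (S : Set Q) (a : A), D.rres (sSup S) a = ⨆ q ∈ S, D.rres q a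
  rres_sSup_right : ∀ (q : Q) (S : Set A), D.rres q (sSup S) = ⨆ a ∈ S, D.rres q a
  rres_inf : ∀ (q : Q) (a b : A), D.rres q (a ⊓ b) = D.rres (D.rres q a) b
  rres_top : ∀ q : Q, D.rres q ⊤ = q
  rres_lres : ∀ (a b : A) (q : Q), D.rres (D.lres a q) b = D.lres a (D.rres q b)

/-- `Q` is an `A`-`A`-quantale. -/
structure IsBimoduleQuantale (D : QuantaleOps A Q) : Prop extends IsBimodule D where
  mul_assoc : ∀ x y z : Q, D.mul (D.mul x y) z = D.mul x (D.mul y z)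
  mul_sSup : ∀ (x : Q) (S : Set Q), D.mul x (sSup S) = ⨆ y ∈ S, D.mul x y
  sSup_mul : ∀ (S : Set Q) (y : Q), D.mul (sSup S) y = ⨆ x ∈ S, D.mul x y
  lres_mul : ∀ (a : A) (x y : Q), D.mul (D.lres a x) y = D.lres a (D.mul x y)
  rres_mul : ∀ (x : Q) (a : A) (y : Q), D.mul (D.rres x a) y = D.mul x (D.lres a y)
  mul_rres : ∀ (x y : Q) (a : A), D.rres (D.mul x y) a = D.mul x (D.rres y a)

/-- `Q` is a based quantale: an involutive `A`-`A`-quantale. -/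
structure IsBased (D : QuantaleOps A Q) : Prop extends IsBimoduleQuantale D where
  star_star : ∀ x : Q, D.star (D.star x) = x
  star_mul : ∀ x y : Q, D.star (D.mul x y) = D.mul (D.star y) (D.star x)
  star_sSup : ∀ S : Set Q, D.star (sSup S) = ⨆ x ∈ S, D.star x
  star_res : ∀ (a b : A) (x : Q),
    D.star (D.lres a (D.rres x b)) = D.lres b (D.rres (D.star x) a)

/-- `Q` is a based quantal frame. -/
structure IsQuantalFrame (D : QuantaleOps A Q) : Prop extends IsBased D where
  lres_inf_elem : ∀ (a : A) (q m : Q), D.lres a q ⊓ m = D.lres a (q ⊓ m)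
  inf_rres_elem : ∀ (m q : Q) (a : A), m ⊓ D.rres q a = D.rres (q ⊓ m) a

/-- `supp` is an equivariant support. -/
structure IsEquivariantSupport (D : QuantaleOps A Q) : Prop where
  supp_sSup : ∀ S : Set Q, D.supp (sSup S) = ⨆ x ∈ S, D.supp x
  supp_top : D.supp ⊤ = ⊤
  supp_le : ∀ x y : Q, D.lres (D.supp x) y ≤ D.mul (D.mul x (D.star x)) y
  supp_self : ∀ x : Q, D.lres (D.supp x) x = x
  supp_lres : ∀ (a : A) (x : Q), D.supp (D.lres a x) = a ⊓ D.supp x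

/-- `υ` makes `Q` reflexive. -/
structure IsReflexive (D : QuantaleOps A Q) : Prop where
  ups_lres : ∀ a : A, D.ups (D.lres a ⊤) = a
  ups_rres : ∀ a : A, D.ups (D.rres ⊤ a) = a

/-- The sup-lattice homomorphism `μ_A : Q ⊗_A Q → Q` induced by the multiplication. -/
def mulTensor (D : QuantaleOps A Q) : SupTensor D.rres D.lres → Q := SupTensor.lift D.mul

/-- The right adjoint of `μ_A : Q ⊗_A Q → Q` exists and preserves joins. -/
def IsMultiplicative (D : QuantaleOps A Q) : Prop :=
  ∃ g : Q → SupTensor D.rres D.lres,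
    GaloisConnection D.mulTensor g ∧ ∀ S : Set Q, g (sSup S) = ⨆ x ∈ S, g x

/-- Groupoid quantales: multiplicative equivariantly supported reflexive quantal frames that
satisfy the unit laws and the inverse laws. -/
structure IsGroupoidQuantale (D : QuantaleOps A Q) : Prop where
  quantalFrame : D.IsQuantalFrame
  support : D.IsEquivariantSupport
  reflexive : D.IsReflexive
  multiplicative : D.IsMultiplicative
  unit_laws : ∀ a : Q, ⨆ (x : Q) (y : Q) (_ : D.mul x y ≤ a), D.lres (D.ups x) y = a
  inverse_laws : ∀ a : Q, D.lres (D.ups a) ⊤ = ⨆ (x : Q) (_ : D.mul x (D.star x) ≤ a), x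

end QuantaleOps

/-! ### `Q`-modules, `Q`-locales and principal `Q`-locales -/

/-- The operations of a supported pre-Hilbert `Q`-module `X`: the actions `q · x` and `a|x`, the
inner product and the support. The laws are in the predicates below. -/
structure ModuleOps (A Q X : Type*) where
  act : Q → X → X
  lres : A → X → X
  ip : X → X → Q
  supp : X → A

namespace ModuleOps

variable {A Q X : Type*} [Order.Frame A] [Order.Frame Q] [Order.Frame X]

/-- `X` is a left `Q`-module. -/
structure IsModule (D : QuantaleOps A Q) (E : ModuleOps A Q X) : Prop where
  act_sSup_left : ∀ (S : Set Q) (x : X), E.act (sSup S) x = ⨆ q ∈ S, E.act q x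
  act_sSup_right : ∀ (q : Q) (S : Set X), E.act q (sSup S) = ⨆ x ∈ S, E.act q x
  mul_act : ∀ (q q' : Q) (x : X), E.act (D.mul q q') x = E.act q (E.act q' x)
  lres_sSup_left : ∀ (S : Set A) (x : X), E.lres (sSup S) x = ⨆ a ∈ S, E.lres a x
  lres_sSup_right : ∀ (a : A) (S : Set X), E.lres a (sSup S) = ⨆ x ∈ S, E.lres a x
  lres_inf : ∀ (a b : A) (x : X), E.lres (a ⊓ b) x = E.lres a (E.lres b x)
  lres_top : ∀ x : X, E.lres ⊤ x = x
  lres_act : ∀ (a : A) (q : Q) (x : X), E.act (D.lres a q) x = E.lres a (E.act q x)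
  rres_act : ∀ (q : Q) (a : A) (x : X), E.act (D.rres q a) x = E.act q (E.lres a x)
  lres_inf_elem : ∀ (a : A) (x y : X), E.lres a (x ⊓ y) = E.lres a x ⊓ y

/-- `X` is a pre-Hilbert `Q`-module. -/
structure IsPreHilbert (D : QuantaleOps A Q) (E : ModuleOps A Q X) : Prop
    extends IsModule D E where
  ip_act : ∀ (q : Q) (x y : X), E.ip (E.act q x) y = D.mul q (E.ip x y)
  ip_lres : ∀ (a : A) (x : X), D.lres a (E.ip x ⊤) = E.ip (E.lres a x) ⊤
  ip_sSup : ∀ (S : Set X) (y : X), E.ip (sSup S) y = ⨆ x ∈ S, E.ip x y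
  ip_star : ∀ x y : X, E.ip x y = D.star (E.ip y x)

/-- `X` is a stably supported `Q`-module. -/
structure IsStablySupported (D : QuantaleOps A Q) (E : ModuleOps A Q X) : Prop
    extends IsPreHilbert D E where
  supp_mono : Monotone E.supp
  supp_top : E.supp ⊤ = ⊤
  supp_le : ∀ x : X, E.lres (E.supp x) ⊤ ≤ E.act (E.ip x x) ⊤
  supp_self : ∀ x : X, E.lres (E.supp x) x = x
  supp_act_le : ∀ (q : Q) (x : X), E.supp (E.act q x) ≤ D.supp q

/-- The map `α_* : X → Q ⊗_A X`, `α_*(x) = ⋁ {q ⊗ y | q · y ≤ x}`. -/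
def actAdj (D : QuantaleOps A Q) (E : ModuleOps A Q X) (x : X) : SupTensor D.rres E.lres :=
  ⨆ (q : Q) (y : X) (_ : E.act q y ≤ x), SupTensor.tmul D.rres E.lres q y

/-- `X` is a `Q`-locale. -/
structure IsQLocale (D : QuantaleOps A Q) (E : ModuleOps A Q X) : Prop
    extends IsStablySupported D E where
  q1 : ∀ S : Set X, E.actAdj D (sSup S) = ⨆ x ∈ S, E.actAdj D x
  q2 : ∀ x : X, ⨆ (q : Q) (y : X) (_ : E.act q y ≤ x), E.lres (D.ups q) y = x

/-- The tensor product `X ⊗_M X` over `M`, where `M` acts on `X` by meets along an inverse image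
homomorphism `φ : M → X`. -/
abbrev BaseTensor {M : Type*} [Order.Frame M] (φ : FrameHom M X) : Type _ :=
  SupTensor (fun (x : X) (m : M) => x ⊓ φ m) (fun (m : M) (x : X) => φ m ⊓ x)

/-- The pure tensor `x ⊗ y` in `X ⊗_M X`. -/
abbrev baseTmul {M : Type*} [Order.Frame M] (φ : FrameHom M X) (x y : X) : BaseTensor φ :=
  SupTensor.tmul (fun (x : X) (m : M) => x ⊓ φ m) (fun (m : M) (x : X) => φ m ⊓ x) x y

/-- `X` is a principal `Q`-locale over `M`, where the `M`-locale structure of `X` is the map of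
locales with inverse image homomorphism `φ : M → X`, and the `M`-valued support is `φ_!`.
In `p3` an isomorphism of frames is the same as an order isomorphism, and as the pure tensors
generate under joins it is determined by its values on them. -/
structure IsPrincipalQLocale {M : Type*} [Order.Frame M]
    (D : QuantaleOps A Q) (E : ModuleOps A Q X) (φ : FrameHom M X) : Prop
    extends IsQLocale D E where
  p1_open : IsOpenFrameHom φ
  p1_top : directIm φ ⊤ = ⊤
  p2 : ∀ (q : Q) (x : X),
    directIm φ (E.act q x) = directIm φ (E.lres (D.supp (D.star q)) x)
  p3 : ∃ e : BaseTensor φ ≃o SupTensor D.rres E.lres, ∀ x y : X,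
    e (baseTmul φ x y) =
      ⨆ (q : Q) (z : X) (_ : E.act q z ≤ x), SupTensor.tmul D.rres E.lres q (z ⊓ y)

end ModuleOps

/-! ### Localic groupoids, their quantales, and principal bundles -/

/-- A localic groupoid: an internal groupoid in the category of locales, with domain map `d`,
range map `r`, units `u`, inversion `i`, and multiplication `m` defined on the pullback `G₂` of
`r` and `d` (so `g h` is defined when `r g = d h`). The laws are stated for generalized elements. -/
structure LocalicGroupoid where
  G₀ : Locale.{u}
  G₁ : Locale.{u}
  G₂ : Locale.{u}
  d : G₁ ⟶ G₀
  r : G₁ ⟶ G₀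
  u : G₀ ⟶ G₁
  i : G₁ ⟶ G₁
  fst : G₂ ⟶ G₁
  snd : G₂ ⟶ G₁
  isPullback : IsPullback fst snd r d
  m : G₂ ⟶ G₁
  u_d : u ≫ d = 𝟙 G₀
  u_r : u ≫ r = 𝟙 G₀
  m_d : m ≫ d = fst ≫ d
  m_r : m ≫ r = snd ≫ r
  i_d : i ≫ d = r
  i_r : i ≫ r = d
  u_m : isPullback.lift (d ≫ u) (𝟙 G₁) (by simp [u_r]) ≫ m = 𝟙 G₁
  m_u : isPullback.lift (𝟙 G₁) (r ≫ u) (by simp [u_d]) ≫ m = 𝟙 G₁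
  assoc : ∀ {Z : Locale.{u}} (f g h : Z ⟶ G₁) (hfg : f ≫ r = g ≫ d) (hgh : g ≫ r = h ≫ d),
    isPullback.lift (isPullback.lift f g hfg ≫ m) h (by simp [m_r, hgh]) ≫ m =
      isPullback.lift f (isPullback.lift g h hgh ≫ m) (by simp [m_d, hfg]) ≫ m
  mul_inv : isPullback.lift (𝟙 G₁) i (by simp [i_d]) ≫ m = d ≫ u
  inv_mul : isPullback.lift i (𝟙 G₁) (by simp [i_r]) ≫ m = r ≫ u

namespace LocalicGroupoid

variable (G : LocalicGroupoid.{u})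

/-- A localic groupoid is open if its domain map is open. -/
def IsOpenGroupoid : Prop := IsOpenLocaleMap G.d

/-- The quantale `𝒪(G)` of an open groupoid, with base locale `G₀`. -/
def quantale : QuantaleOps G.G₀.unop G.G₁.unop where
  lres a q := invIm G.d a ⊓ q
  rres q a := q ⊓ invIm G.r a
  mul x y := dirIm G.m (invIm G.fst x ⊓ invIm G.snd y)
  star x := dirIm G.i x
  supp := dirIm G.d
  ups := invIm G.u

/-- A left `G`-locale, with anchor map `p` and an action on the pullback `P = G₁ ×_{G₀} X` of `r`
and `p`. -/
structure LeftLocale where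
  X : Locale.{u}
  P : Locale.{u}
  p : X ⟶ G.G₀
  fst : P ⟶ G.G₁
  snd : P ⟶ X
  isPullback : IsPullback fst snd G.r p
  act : P ⟶ X
  act_p : act ≫ p = fst ≫ G.d
  assoc : ∀ {Z : Locale.{u}} (g h : Z ⟶ G.G₁) (x : Z ⟶ X)
    (hgh : g ≫ G.r = h ≫ G.d) (hhx : h ≫ G.r = x ≫ p),
    isPullback.lift g (isPullback.lift h x hhx ≫ act) (by simp [act_p, hgh]) ≫ act =
      isPullback.lift (G.isPullback.lift g h hgh ≫ G.m) x (by simp [G.m_r, hhx]) ≫ act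
  unit_act : isPullback.lift (p ≫ G.u) (𝟙 X) (by simp [G.u_r]) ≫ act = 𝟙 X

/-- A left `G`-bundle over `M`. -/
structure Bundle (M : Locale.{u}) extends LeftLocale G where
  proj : X ⟶ M
  act_proj : act ≫ proj = snd ≫ proj

/-- A left principal `G`-bundle over `M`, with `R = X ×_M X`: the projection to `M` is an open
surjection and the pairing map `⟨act, π₂⟩ : G₁ ×_{G₀} X → X ×_M X` is an isomorphism. -/
structure PrincipalBundle (M : Locale.{u}) extends Bundle G M where
  R : Locale.{u}
  fstR : R ⟶ X
  sndR : R ⟶ X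
  isPullbackR : IsPullback fstR sndR proj proj
  proj_open : IsOpenLocaleMap proj
  proj_surj : IsSurjLocaleMap proj
  isIso_pairing : IsIso (isPullbackR.lift act snd act_proj)

namespace PrincipalBundle

variable {G} {M : Locale.{u}} (B : G.PrincipalBundle M)

/-- `B` is fully open: the anchor map `p : X → G₀` is an open surjection. -/
def IsFullyOpen : Prop := IsOpenLocaleMap B.p ∧ IsSurjLocaleMap B.p

/-- The pairing map `⟨act, π₂⟩`. -/
noncomputable def pairing : B.P ⟶ B.R := B.isPullbackR.lift B.act B.snd B.act_proj

instance : IsIso B.pairing := B.isIso_pairing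

/-- The map `θ : X ×_M X → G₁` such that `⟨θ, π₂⟩` is the inverse of the pairing map. -/
noncomputable def theta : B.R ⟶ G.G₁ := inv B.pairing ≫ B.fst

/-- The operations that the bundle induces on the locale `X`: `q · x = act_!(q ⊗ x)`,
`a|x = p^*(a) ∧ x`, `⟨x, y⟩ = θ_!(x ⊗ y)` and support `p_!`. -/
noncomputable def moduleOps : ModuleOps G.G₀.unop G.G₁.unop B.X.unop where
  act q x := dirIm B.act (invIm B.fst q ⊓ invIm B.snd x)
  lres a x := invIm B.p a ⊓ x
  ip x y := dirIm B.theta (invIm B.fstR x ⊓ invIm B.sndR y)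
  supp := dirIm B.p

end PrincipalBundle

end LocalicGroupoid

/-! The frame of a pullback of locales is the balanced tensor product of the frames (`pullbackIso`),
so every open of a pullback is a join of rectangles `x ⊗ y`, and join-preserving maps on it are
controlled by their values on rectangles (`eq_iSup_of_isPullback`). Open maps are stable under
pullback and satisfy Beck–Chevalley (`isOpen_fst`, `dirIm_fst_snd`).

Because groupoid elements are invertible, `(g, x) ↦ (g, gx)` presents `act` as a pullback of `d`
(`isPullback_fst_act`). Hence `act` is open, `q · x` is left adjoint to `act^*` in the sense of
`gc_lift_qact`, and joins are preserved by `act^*`: this yields multiplicativity and (Q1).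
Multiplication of the quantale is the special case of `G` acting on itself by `translation`, so
associativity, the unit laws and the module laws are each proved once, for an arbitrary `G`-locale.
Associativity and the compatibility of the inner product with the action are equalities of direct
images from the locale of triples `(g, h, x)`, obtained from Beck–Chevalley and Frobenius.

The pairing isomorphism turns `θ_!(x ⊗ y)` into `fst_!(act^* x ∧ snd^* y)` (`dirIm_theta`). In that
form the inner product laws and the support inequality hold for every `G`-locale with open anchor
map; the invertibility of the pairing returns only in (P3), where it is the required isomorphism of
tensor products. -/

/-! ### The frame structure on the tensor product of frames -/

namespace SupTensor

section Sup

variable {A Q X : Type*} [CompleteLattice Q] [CompleteLattice X] {ρ : Q → A → Q} {l : A → X → X}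

theorem tmul_le_iff {q : Q} {x : X} {t : SupTensor ρ l} :
    tmul ρ l q x ≤ t ↔ (q, x) ∈ t.carrier := by
  refine ⟨fun h => h fun s hs => hs, fun h => sInf_le h⟩

theorem mem_inf {s t : SupTensor ρ l} {p : Q × X} :
    p ∈ (s ⊓ t).carrier ↔ p ∈ s.carrier ∧ p ∈ t.carrier := by
  obtain ⟨q, x⟩ := p
  simp only [← tmul_le_iff, le_inf_iff]

theorem eq_iSup_tmul (t : SupTensor ρ l) : t = ⨆ p ∈ t.carrier, tmul ρ l p.1 p.2 := by
  refine le_antisymm (fun p hp => ?_) (iSup₂_le fun p hp => tmul_le_iff.2 hp)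
  exact tmul_le_iff.1 (le_iSup₂ (f := fun (p : Q × X) (_ : p ∈ t.carrier) => tmul ρ l p.1 p.2) p hp)

theorem tmul_mono {q q' : Q} {x x' : X} (hq : q ≤ q') (hx : x ≤ x') :
    tmul ρ l q x ≤ tmul ρ l q' x' :=
  tmul_le_iff.2 (down _ _ _ _ _ hq hx (tmul_le_iff.1 le_rfl))

theorem tmul_balanced (q : Q) (a : A) (x : X) : tmul ρ l (ρ q a) x = tmul ρ l q (l a x) :=
  le_antisymm (tmul_le_iff.2 ((balanced _ _ _ _).2 (tmul_le_iff.1 le_rfl)))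
    (tmul_le_iff.2 ((balanced _ _ _ _).1 (tmul_le_iff.1 le_rfl)))

/-- Maps `Q × X → Z` that preserve joins in each variable and are balanced over `A`. -/
structure IsBalanced {Z : Type*} [CompleteLattice Z] (ρ : Q → A → Q) (l : A → X → X)
    (F : Q → X → Z) : Prop where
  sSup_left : ∀ (S : Set Q) (x : X), F (sSup S) x = ⨆ q ∈ S, F q x
  sSup_right : ∀ (q : Q) (S : Set X), F q (sSup S) = ⨆ x ∈ S, F q x
  balanced : ∀ (q : Q) (a : A) (x : X), F (ρ q a) x = F q (l a x)

namespace IsBalanced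

variable {Z : Type*} [CompleteLattice Z] {F : Q → X → Z} (hF : IsBalanced ρ l F)
include hF

theorem mono {q q' : Q} {x x' : X} (hq : q ≤ q') (hx : x ≤ x') : F q x ≤ F q' x' := by
  have h1 := hF.sSup_left {q, q'} x
  have h2 := hF.sSup_right q' {x, x'}
  rw [sSup_pair, sup_eq_right.2 hq, iSup_pair] at h1
  rw [sSup_pair, sup_eq_right.2 hx, iSup_pair] at h2
  rw [h2]
  refine le_trans ?_ le_sup_left
  rw [h1]
  exact le_sup_left

/-- The right adjoint of the homomorphism induced by a balanced map. -/
def adj (z : Z) : SupTensor ρ l where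
  carrier := {p | F p.1 p.2 ≤ z}
  down _ _ _ _ hq hx h := (hF.mono hq hx).trans h
  sup_left S x h := by
    change F (sSup S) x ≤ z
    rw [hF.sSup_left]
    exact iSup₂_le h
  sup_right q S h := by
    change F q (sSup S) ≤ z
    rw [hF.sSup_right]
    exact iSup₂_le h
  balanced q a x := by
    change F _ _ ≤ z ↔ F _ _ ≤ z
    rw [hF.balanced]

theorem gc_lift : GaloisConnection (lift F : SupTensor ρ l → Z) hF.adj := fun t z => by
  simp only [lift, iSup₂_le_iff]
  rfl

theorem lift_tmul (q : Q) (x : X) : lift F (tmul ρ l q x) = F q x :=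
  le_antisymm (hF.gc_lift.l_le (tmul_le_iff.2 le_rfl))
    (le_iSup₂ (f := fun (p : Q × X) (_ : p ∈ (tmul ρ l q x).carrier) => F p.1 p.2) (q, x)
      (tmul_le_iff.1 le_rfl))

end IsBalanced

end Sup

end SupTensor

section FrameTensor

variable {A Q X : Type*} [Order.Frame A] [Order.Frame Q] [Order.Frame X]
  (f : FrameHom A Q) (g : FrameHom A X)

/-- The tensor product of frames along two frame homomorphisms. -/
abbrev FrameTensor : Type _ :=
  SupTensor (fun (q : Q) (a : A) => q ⊓ f a) (fun (a : A) (x : X) => g a ⊓ x)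

/-- The pure tensors of a tensor product of frames. -/
abbrev ftmul (q : Q) (x : X) : FrameTensor f g :=
  SupTensor.tmul (fun (q : Q) (a : A) => q ⊓ f a) (fun (a : A) (x : X) => g a ⊓ x) q x

namespace FrameTensor

variable {f g}

/-- The largest element whose meet with `q ⊗ x` lies below `t`. -/
def residual (p : Q × X) (t : FrameTensor f g) : FrameTensor f g where
  carrier := {p' | p ⊓ p' ∈ t.carrier}
  down q q' x x' hq hx h :=
    t.down _ _ _ _ (inf_le_inf_left _ hq) (inf_le_inf_left _ hx) h
  sup_left S x h := by
    change (p.1 ⊓ sSup S, p.2 ⊓ x) ∈ t.carrier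
    rw [inf_sSup_eq, ← sSup_image]
    refine t.sup_left _ _ ?_
    rintro _ ⟨q, hq, rfl⟩
    exact h q hq
  sup_right q S h := by
    change (p.1 ⊓ q, p.2 ⊓ sSup S) ∈ t.carrier
    rw [inf_sSup_eq, ← sSup_image]
    refine t.sup_right _ _ ?_
    rintro _ ⟨x, hx, rfl⟩
    exact h x hx
  balanced q a x := by
    change (p.1 ⊓ (q ⊓ f a), p.2 ⊓ x) ∈ t.carrier ↔ (p.1 ⊓ q, p.2 ⊓ (g a ⊓ x)) ∈ t.carrier
    rw [← inf_assoc, inf_left_comm p.2]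
    exact t.balanced _ _ _

theorem mem_residual {p p' : Q × X} {t : FrameTensor f g} :
    p' ∈ (residual p t).carrier ↔ p ⊓ p' ∈ t.carrier := Iff.rfl

/-- For `p` in `t ⊓ sSup S`, every `s ∈ S` lies below the residual at `p` of `⨆ t ⊓ s`, hence so
does `sSup S ∋ p`. Therefore `p ⊓ p = p` belongs to that join. -/
instance : Order.Frame (FrameTensor f g) :=
  Order.Frame.ofMinimalAxioms
    { inf_sSup_le_iSup_inf := fun t S p hp => by
        obtain ⟨hp1, hp2⟩ := SupTensor.mem_inf.1 hp
        have h : sSup S ≤ residual p (⨆ s ∈ S, t ⊓ s) := by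
          refine sSup_le fun s hs p' hp' => ?_
          refine le_iSup₂ (f := fun s (_ : s ∈ S) => t ⊓ s) s hs ?_
          exact SupTensor.mem_inf.2 ⟨t.down _ _ _ _ inf_le_left inf_le_left hp1,
            s.down _ _ _ _ inf_le_right inf_le_right hp'⟩
        have := h hp2
        rwa [mem_residual, inf_idem] at this }

/-- Residuals replace a description of the elements of a pure tensor: it suffices to test
generators. One residual, at `(q, x)`, passes from the pair `(q', x')` to all members of `q' ⊗ x'`;
a second, at `p`, passes from `(q, x)` to all members of `q ⊗ x`. -/
theorem ftmul_inf (q q' : Q) (x x' : X) :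
    ftmul f g q x ⊓ ftmul f g q' x' = ftmul f g (q ⊓ q') (x ⊓ x') := by
  refine le_antisymm ?_ (le_inf (SupTensor.tmul_mono inf_le_left inf_le_left)
    (SupTensor.tmul_mono inf_le_right inf_le_right))
  intro p hp
  obtain ⟨hp1, hp2⟩ := SupTensor.mem_inf.1 hp
  have h : ftmul f g q x ≤ residual p (ftmul f g (q ⊓ q') (x ⊓ x')) := by
    have h' : ftmul f g q' x' ≤ residual (q, x) (ftmul f g (q ⊓ q') (x ⊓ x')) :=
      SupTensor.tmul_le_iff.2 (mem_residual.2 (SupTensor.tmul_le_iff.1 (le_refl (ftmul f g _ _))))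
    have := h' hp2
    refine SupTensor.tmul_le_iff.2 (mem_residual.2 ?_)
    rwa [mem_residual, inf_comm (q, x)] at this
  have := h hp1
  rwa [mem_residual, inf_idem] at this

theorem ftmul_top : ftmul f g ⊤ ⊤ = ⊤ := by
  refine top_unique fun p _ => ?_
  exact SupTensor.down _ _ _ _ _ le_top le_top (SupTensor.tmul_le_iff.1 le_rfl)

theorem ftmul_sSup_left (S : Set Q) (x : X) : ftmul f g (sSup S) x = ⨆ q ∈ S, ftmul f g q x := by
  refine le_antisymm (SupTensor.tmul_le_iff.2 (SupTensor.sup_left _ _ _ fun q hq => ?_))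
    (iSup₂_le fun q hq => SupTensor.tmul_mono (le_sSup hq) le_rfl)
  exact SupTensor.tmul_le_iff.1 (le_iSup₂ (f := fun q (_ : q ∈ S) => ftmul f g q x) q hq)

theorem ftmul_sSup_right (q : Q) (S : Set X) : ftmul f g q (sSup S) = ⨆ x ∈ S, ftmul f g q x := by
  refine le_antisymm (SupTensor.tmul_le_iff.2 (SupTensor.sup_right _ _ _ fun x hx => ?_))
    (iSup₂_le fun x hx => SupTensor.tmul_mono le_rfl (le_sSup hx))
  exact SupTensor.tmul_le_iff.1 (le_iSup₂ (f := fun x (_ : x ∈ S) => ftmul f g q x) x hx)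

variable (f g)

/-- The first coprojection. -/
def inl : FrameHom Q (FrameTensor f g) where
  toFun q := ftmul f g q ⊤
  map_inf' q q' := by rw [ftmul_inf, inf_idem]
  map_top' := ftmul_top
  map_sSup' S := by rw [ftmul_sSup_left, sSup_image]

/-- The second coprojection. -/
def inr : FrameHom X (FrameTensor f g) where
  toFun x := ftmul f g ⊤ x
  map_inf' x x' := by rw [ftmul_inf, inf_idem]
  map_top' := ftmul_top
  map_sSup' S := by rw [ftmul_sSup_right, sSup_image]

variable {f g}

theorem inl_inf_inr (q : Q) (x : X) : inl f g q ⊓ inr f g x = ftmul f g q x := by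
  change ftmul f g q ⊤ ⊓ ftmul f g ⊤ x = _
  rw [ftmul_inf, inf_top_eq, top_inf_eq]

theorem inl_comp_eq_inr_comp (a : A) : inl f g (f a) = inr f g (g a) := by
  have := SupTensor.tmul_balanced (ρ := fun (q : Q) (a : A) => q ⊓ f a)
    (l := fun (a : A) (x : X) => g a ⊓ x) ⊤ a ⊤
  simp only [top_inf_eq, inf_top_eq] at this
  exact this

variable {Z : Type*} [Order.Frame Z]

theorem isBalanced_inf (h : FrameHom Q Z) (k : FrameHom X Z) (hk : ∀ a, h (f a) = k (g a)) :
    SupTensor.IsBalanced (fun (q : Q) (a : A) => q ⊓ f a) (fun (a : A) (x : X) => g a ⊓ x)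
      (fun q x => h q ⊓ k x) where
  sSup_left S x := by rw [map_sSup, sSup_inf_eq, iSup_image]
  sSup_right q S := by rw [map_sSup, inf_sSup_eq, iSup_image]
  balanced q a x := by rw [map_inf, map_inf, hk, inf_assoc]

/-- The frame homomorphism on a tensor product induced by a cocone. -/
def desc (h : FrameHom Q Z) (k : FrameHom X Z) (hk : ∀ a, h (f a) = k (g a)) :
    FrameHom (FrameTensor f g) Z where
  toFun := SupTensor.lift fun q x => h q ⊓ k x
  map_inf' s t := by
    have H := isBalanced_inf h k hk
    refine le_antisymm (H.gc_lift.monotone_l.map_inf_le s t) ?_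
    simp only [SupTensor.lift, iSup_inf_eq, inf_iSup_eq, iSup_le_iff]
    -- By down-closure the componentwise meet of a member of `s` and a member of `t` belongs to `s ⊓
    -- t`.
    intro p hp p' hp'
    refine le_trans (le_of_eq ?_) (le_iSup₂ (f := fun (p : Q × X) (_ : p ∈ (s ⊓ t).carrier) =>
      h p.1 ⊓ k p.2) (p' ⊓ p) (SupTensor.mem_inf.2
        ⟨s.down _ _ _ _ inf_le_left inf_le_left hp',
          t.down _ _ _ _ inf_le_right inf_le_right hp⟩))
    simp only [Prod.fst_inf, Prod.snd_inf, map_inf]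
    rw [inf_inf_inf_comm]
  map_top' := by
    rw [← ftmul_top (f := f) (g := g), (isBalanced_inf h k hk).lift_tmul, map_top, map_top,
      inf_top_eq]
  map_sSup' S := by rw [(isBalanced_inf h k hk).gc_lift.l_sSup, sSup_image]

theorem desc_ftmul (h : FrameHom Q Z) (k : FrameHom X Z) (hk : ∀ a, h (f a) = k (g a)) (q : Q)
    (x : X) : desc h k hk (ftmul f g q x) = h q ⊓ k x :=
  (isBalanced_inf h k hk).lift_tmul q x

theorem desc_inl (h : FrameHom Q Z) (k : FrameHom X Z) (hk : ∀ a, h (f a) = k (g a)) (q : Q) :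
    desc h k hk (inl f g q) = h q :=
  (desc_ftmul h k hk q ⊤).trans (by rw [map_top, inf_top_eq])

theorem desc_inr (h : FrameHom Q Z) (k : FrameHom X Z) (hk : ∀ a, h (f a) = k (g a)) (x : X) :
    desc h k hk (inr f g x) = k x :=
  (desc_ftmul h k hk ⊤ x).trans (by rw [map_top, top_inf_eq])

theorem hom_ext {h k : FrameHom (FrameTensor f g) Z} (hl : ∀ q, h (inl f g q) = k (inl f g q))
    (hr : ∀ x, h (inr f g x) = k (inr f g x)) : h = k := by
  ext t
  rw [SupTensor.eq_iSup_tmul t]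
  simp only [map_iSup, ← inl_inf_inr, map_inf, hl, hr]

end FrameTensor

end FrameTensor

/-! ### Open frame homomorphisms -/

section OpenFrameHom

variable {X Y Z : Type*} [Order.Frame X] [Order.Frame Y] [Order.Frame Z]

/-- Any explicit left adjoint computes the infimum that defines `directIm`; every formula for a
direct image below is obtained by exhibiting such an adjoint. -/
theorem directIm_eq_of_gc {φ : FrameHom Y X} {l : X → Y} (h : GaloisConnection l φ) :
    directIm φ = l := by
  funext x
  exact le_antisymm (sInf_le (h.le_u_l x)) (le_sInf fun y hy => h.l_le hy)

theorem gc_directIm {φ : FrameHom Y X} {l : X → Y} (h : GaloisConnection l φ) :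
    GaloisConnection (directIm φ) φ := by
  rwa [directIm_eq_of_gc h]

theorem IsOpenFrameHom.comp {φ : FrameHom Y X} {ψ : FrameHom Z Y} (hφ : IsOpenFrameHom φ)
    (hψ : IsOpenFrameHom ψ) :
    IsOpenFrameHom (φ.comp ψ) ∧ ∀ x, directIm (φ.comp ψ) x = directIm ψ (directIm φ x) := by
  have h : GaloisConnection (fun x => directIm ψ (directIm φ x)) (φ.comp ψ) :=
    hφ.gc.compose hψ.gc
  have e := directIm_eq_of_gc h
  refine ⟨⟨gc_directIm h, fun x y => ?_⟩, fun x => congrFun e x⟩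
  rw [e]
  change directIm ψ (directIm φ (x ⊓ φ (ψ y))) = _
  rw [hφ.frobenius, hψ.frobenius]

end OpenFrameHom

/-! ### Direct and inverse images along maps of locales. -/

section Locale

variable {X Y Z : Locale.{u}}

@[simp]
theorem invIm_comp (f : X ⟶ Y) (g : Y ⟶ Z) (z : Z.unop) :
    invIm (f ≫ g) z = invIm f (invIm g z) := rfl

@[simp]
theorem invIm_id (x : X.unop) : invIm (𝟙 X) x = x := rfl

theorem invIm_congr {f g : X ⟶ Y} (h : f = g) (y : Y.unop) : invIm f y = invIm g y := by rw [h]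

theorem locale_hom_ext {f g : X ⟶ Y} (h : ∀ y, invIm f y = invIm g y) : f = g := by
  apply Quiver.Hom.unop_inj
  apply Frm.hom_ext
  ext y
  exact h y

namespace IsOpenLocaleMap

variable {f : X ⟶ Y} (hf : IsOpenLocaleMap f)
include hf

theorem dirIm_le_iff {x : X.unop} {y : Y.unop} : dirIm f x ≤ y ↔ x ≤ invIm f y := hf.gc x y

theorem le_invIm_dirIm (x : X.unop) : x ≤ invIm f (dirIm f x) := hf.gc.le_u_l x

theorem dirIm_mono {x x' : X.unop} (h : x ≤ x') : dirIm f x ≤ dirIm f x' := hf.gc.monotone_l h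

theorem dirIm_sSup (S : Set X.unop) : dirIm f (sSup S) = ⨆ x ∈ S, dirIm f x := hf.gc.l_sSup

theorem dirIm_iSup {ι : Sort*} (x : ι → X.unop) : dirIm f (⨆ k, x k) = ⨆ k, dirIm f (x k) :=
  hf.gc.l_iSup

theorem dirIm_inf_invIm (x : X.unop) (y : Y.unop) :
    dirIm f (x ⊓ invIm f y) = dirIm f x ⊓ y := hf.frobenius x y

theorem dirIm_invIm_inf (x : X.unop) (y : Y.unop) :
    dirIm f (invIm f y ⊓ x) = y ⊓ dirIm f x := by
  rw [inf_comm, hf.dirIm_inf_invIm, inf_comm]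

theorem comp {g : Y ⟶ Z} (hg : IsOpenLocaleMap g) : IsOpenLocaleMap (f ≫ g) :=
  (IsOpenFrameHom.comp hf hg).1

theorem dirIm_comp {g : Y ⟶ Z} (hg : IsOpenLocaleMap g) (x : X.unop) :
    dirIm (f ≫ g) x = dirIm g (dirIm f x) :=
  (IsOpenFrameHom.comp hf hg).2 x

theorem invIm_section_le {s : Y ⟶ X} (hs : s ≫ f = 𝟙 Y) (x : X.unop) :
    invIm s x ≤ dirIm f x := by
  have h := OrderHomClass.mono (invIm s) (hf.le_invIm_dirIm x)
  rwa [← invIm_comp, hs, invIm_id] at h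

theorem dirIm_top_of_surj (h : IsSurjLocaleMap f) : dirIm f ⊤ = ⊤ := by
  apply h
  rw [map_top]
  exact top_unique (hf.le_invIm_dirIm ⊤)

end IsOpenLocaleMap

theorem isSurjLocaleMap_of_section {f : X ⟶ Y} {s : Y ⟶ X} (hs : s ≫ f = 𝟙 Y) :
    IsSurjLocaleMap f := fun y y' h => by
  have := congrArg (invIm s) h
  rwa [← invIm_comp, ← invIm_comp, hs] at this

theorem gc_invIm_of_inverse {f : X ⟶ Y} {g : Y ⟶ X} (h : f ≫ g = 𝟙 X) (h' : g ≫ f = 𝟙 Y) :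
    GaloisConnection (invIm g) (invIm f) := fun x y => by
  refine ⟨fun k => ?_, fun k => ?_⟩
  · have := OrderHomClass.mono (invIm f) k
    rwa [← invIm_comp, h] at this
  · have := OrderHomClass.mono (invIm g) k
    rwa [← invIm_comp g f, h'] at this

theorem dirIm_of_inverse {f : X ⟶ Y} {g : Y ⟶ X} (h : f ≫ g = 𝟙 X) (h' : g ≫ f = 𝟙 Y)
    (x : X.unop) : dirIm f x = invIm g x :=
  congrFun (directIm_eq_of_gc (gc_invIm_of_inverse h h')) x

theorem isOpenLocaleMap_of_inverse {f : X ⟶ Y} {g : Y ⟶ X} (h : f ≫ g = 𝟙 X)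
    (h' : g ≫ f = 𝟙 Y) : IsOpenLocaleMap f where
  gc := gc_directIm (gc_invIm_of_inverse h h')
  frobenius x y := by
    rw [show directIm (invIm f) = invIm g from directIm_eq_of_gc (gc_invIm_of_inverse h h'),
      map_inf, ← invIm_comp g f, h', invIm_id]

/-- The order isomorphism of frames given by an isomorphism of locales. -/
def orderIsoOfInverse {f : X ⟶ Y} {g : Y ⟶ X} (h : f ≫ g = 𝟙 X) (h' : g ≫ f = 𝟙 Y) :
    Y.unop ≃o X.unop where
  toFun := invIm f
  invFun := invIm g
  left_inv y := by rw [← invIm_comp, h', invIm_id]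
  right_inv x := by rw [← invIm_comp, h, invIm_id]
  map_rel_iff' {y y'} := by
    refine ⟨fun k => ?_, fun k => OrderHomClass.mono (invIm f) k⟩
    have := OrderHomClass.mono (invIm g) k
    change invIm g (invIm f y) ≤ invIm g (invIm f y') at this
    rwa [← invIm_comp, ← invIm_comp, h', invIm_id, invIm_id] at this

/-! ### Pullbacks of locales -/

/-- The pullback of two maps of locales. -/
abbrev pullbackLocale (f : X ⟶ Z) (g : Y ⟶ Z) : Locale.{u} :=
  Locale.of (FrameTensor (invIm f) (invIm g))

/-- The first projection from the pullback. -/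
abbrev pullbackFst (f : X ⟶ Z) (g : Y ⟶ Z) : pullbackLocale f g ⟶ X :=
  (Frm.ofHom (FrameTensor.inl (invIm f) (invIm g))).op

/-- The second projection from the pullback. -/
abbrev pullbackSnd (f : X ⟶ Z) (g : Y ⟶ Z) : pullbackLocale f g ⟶ Y :=
  (Frm.ofHom (FrameTensor.inr (invIm f) (invIm g))).op

/-- The tensor product is the pushout of frames: `desc` supplies mediating maps, and uniqueness
holds because meets of the two coprojections generate under joins. -/
theorem isPullback_pullbackLocale (f : X ⟶ Z) (g : Y ⟶ Z) :
    IsPullback (pullbackFst f g) (pullbackSnd f g) f g where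
  w := locale_hom_ext fun a => FrameTensor.inl_comp_eq_inr_comp a
  isLimit' := ⟨Limits.PullbackCone.IsLimit.mk _
    (fun s => (Frm.ofHom (FrameTensor.desc (invIm s.fst) (invIm s.snd)
      (fun a => invIm_congr s.condition a))).op)
    (fun s => locale_hom_ext fun q => FrameTensor.desc_inl (invIm s.fst) (invIm s.snd)
      (fun a => invIm_congr s.condition a) q)
    (fun s => locale_hom_ext fun x => FrameTensor.desc_inr (invIm s.fst) (invIm s.snd)
      (fun a => invIm_congr s.condition a) x)
    (fun s k h1 h2 => by
      refine locale_hom_ext fun t => DFunLike.congr_fun (FrameTensor.hom_ext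
        (h := invIm k) (k := FrameTensor.desc (invIm s.fst) (invIm s.snd)
          (fun a => invIm_congr s.condition a)) (fun q => ?_) (fun x => ?_)) t
      · exact (invIm_congr h1 q).trans (FrameTensor.desc_inl _ _ _ q).symm
      · exact (invIm_congr h2 x).trans (FrameTensor.desc_inr _ _ _ x).symm)⟩

end Locale

section Pullback

variable {P X Y Z : Locale.{u}} {p : P ⟶ X} {q : P ⟶ Y} {f : X ⟶ Z} {g : Y ⟶ Z}

/-- The frame of a pullback of locales is the tensor product of the frames. -/
noncomputable def pullbackIso (h : IsPullback p q f g) :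
    P.unop ≃o FrameTensor (invIm f) (invIm g) :=
  orderIsoOfInverse (X := pullbackLocale f g) (Y := P)
    (f := h.lift _ _ (isPullback_pullbackLocale f g).w)
    (g := (isPullback_pullbackLocale f g).lift _ _ h.w)
    (by apply (isPullback_pullbackLocale f g).hom_ext <;> simp)
    (by apply h.hom_ext <;> simp)

theorem pullbackIso_tmul (h : IsPullback p q f g) (x : X.unop) (y : Y.unop) :
    pullbackIso h (invIm p x ⊓ invIm q y) = ftmul (invIm f) (invIm g) x y := by
  change invIm (h.lift _ _ (isPullback_pullbackLocale f g).w) _ = _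
  rw [map_inf, ← invIm_comp, ← invIm_comp, h.lift_fst, h.lift_snd]
  exact FrameTensor.inl_inf_inr x y

theorem eq_iSup_of_isPullback (h : IsPullback p q f g) (t : P.unop) :
    t = ⨆ (x : X.unop) (y : Y.unop) (_ : invIm p x ⊓ invIm q y ≤ t), invIm p x ⊓ invIm q y := by
  refine le_antisymm ?_ (iSup_le fun x => iSup_le fun y => iSup_le fun hxy => hxy)
  rw [← (pullbackIso h).le_iff_le, SupTensor.eq_iSup_tmul (pullbackIso h t)]
  refine iSup₂_le fun k hk => ?_
  have hk' := SupTensor.tmul_le_iff.2 hk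
  have hk'' := (pullbackIso_tmul h k.1 k.2).le.trans hk'
  refine (pullbackIso_tmul h k.1 k.2).ge.trans ?_
  rw [(pullbackIso h).le_iff_le] at hk'' ⊢
  exact le_iSup_of_le k.1 (le_iSup_of_le k.2 (le_iSup_of_le hk'' le_rfl))

theorem le_of_isPullback (h : IsPullback p q f g) {s t : P.unop}
    (hst : ∀ x y, invIm p x ⊓ invIm q y ≤ s → invIm p x ⊓ invIm q y ≤ t) : s ≤ t := by
  rw [eq_iSup_of_isPullback h s]
  exact iSup_le fun x => iSup_le fun y => iSup_le fun hxy => hst x y hxy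

/-! ### Open maps under pullback, and Beck–Chevalley. -/

theorem isBalanced_dirIm (f : X ⟶ Z) (hg : IsOpenLocaleMap g) :
    SupTensor.IsBalanced (fun (x : X.unop) (a : Z.unop) => x ⊓ invIm f a)
      (fun (a : Z.unop) (y : Y.unop) => invIm g a ⊓ y)
      (fun x y => x ⊓ invIm f (dirIm g y)) where
  sSup_left S y := by rw [sSup_inf_eq]
  sSup_right x S := by
    rw [hg.dirIm_sSup]
    simp only [map_iSup, inf_iSup_eq]
  balanced x a y := by rw [hg.dirIm_invIm_inf, map_inf, inf_assoc]

/-- The formula `x ⊗ y ↦ x ∧ f^*(g_! y)` is balanced by Frobenius for `g`. On rectangles the unit `y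
≤ g^* g_! y` and commutativity of the square give one half of the adjunction; the other half is the
value `x ∧ f^*(g_! 1) ≤ x` at `x ⊗ 1`. -/
theorem gc_pullback_fst (h : IsPullback p q f g) (hg : IsOpenLocaleMap g) :
    GaloisConnection (fun t => SupTensor.lift (fun x y => x ⊓ invIm f (dirIm g y))
      (pullbackIso h t)) (invIm p) := by
  have H := isBalanced_dirIm f hg
  intro t x
  constructor
  · intro k
    refine le_of_isPullback h fun x' y' hxy => ?_
    have h1 : x' ⊓ invIm f (dirIm g y') ≤ x := by
      refine le_trans ?_ k
      rw [← H.lift_tmul]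
      refine H.gc_lift.monotone_l ?_
      have := (pullbackIso h).monotone hxy
      rwa [pullbackIso_tmul] at this
    calc invIm p x' ⊓ invIm q y' ≤ invIm p x' ⊓ invIm q (invIm g (dirIm g y')) :=
          inf_le_inf_left _ (OrderHomClass.mono (invIm q) (hg.le_invIm_dirIm y'))
      _ = invIm p (x' ⊓ invIm f (dirIm g y')) := by
          rw [map_inf, ← invIm_comp, ← invIm_comp, h.w]
      _ ≤ invIm p x := OrderHomClass.mono (invIm p) h1
  · intro k
    have h1 : pullbackIso h (invIm p x) = ftmul (invIm f) (invIm g) x ⊤ := by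
      rw [← pullbackIso_tmul h, map_top, inf_top_eq]
    refine (H.gc_lift.monotone_l ((pullbackIso h).monotone k)).trans ?_
    rw [h1]
    exact (H.lift_tmul _ _).le.trans inf_le_left

theorem dirIm_fst_tmul (h : IsPullback p q f g) (hg : IsOpenLocaleMap g) (x : X.unop)
    (y : Y.unop) : dirIm p (invIm p x ⊓ invIm q y) = x ⊓ invIm f (dirIm g y) := by
  rw [show dirIm p = _ from directIm_eq_of_gc (gc_pullback_fst h hg)]
  exact (congrArg _ (pullbackIso_tmul h x y)).trans ((isBalanced_dirIm f hg).lift_tmul x y)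

theorem isOpen_fst (h : IsPullback p q f g) (hg : IsOpenLocaleMap g) : IsOpenLocaleMap p where
  gc := gc_directIm (gc_pullback_fst h hg)
  frobenius t x := by
    have gc := gc_directIm (gc_pullback_fst h hg)
    rw [eq_iSup_of_isPullback h t]
    simp only [iSup_inf_eq, gc.l_iSup]
    refine iSup_congr fun x' => iSup_congr fun y => iSup_congr fun _ => ?_
    rw [inf_right_comm, ← map_inf]
    refine (dirIm_fst_tmul h hg _ _).trans ?_
    rw [inf_right_comm, ← dirIm_fst_tmul h hg]

/-- The Beck–Chevalley condition for the pullback of an open map. -/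
theorem dirIm_fst_snd (h : IsPullback p q f g) (hg : IsOpenLocaleMap g) (y : Y.unop) :
    dirIm p (invIm q y) = invIm f (dirIm g y) := by
  have := dirIm_fst_tmul h hg ⊤ y
  rwa [map_top, top_inf_eq, top_inf_eq] at this

theorem isOpen_snd (h : IsPullback p q f g) (hf : IsOpenLocaleMap f) : IsOpenLocaleMap q :=
  isOpen_fst h.flip hf

theorem dirIm_snd_fst (h : IsPullback p q f g) (hf : IsOpenLocaleMap f) (x : X.unop) :
    dirIm q (invIm p x) = invIm g (dirIm f x) :=
  dirIm_fst_snd h.flip hf x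

end Pullback

/-! ### Generalized elements of localic groupoids and their actions -/

/-- Lifts need only exist as a proposition, so pullback squares can be verified by solving equations
between generalized elements. -/
theorem isPullback_of_elements {C : Type*} [Category C] {P X Y Z : C} {p : P ⟶ X} {q : P ⟶ Y}
    {f : X ⟶ Z} {g : Y ⟶ Z} (w : p ≫ f = q ≫ g)
    (ex : ∀ {T : C} (a : T ⟶ X) (b : T ⟶ Y), a ≫ f = b ≫ g → ∃ l : T ⟶ P, l ≫ p = a ∧ l ≫ q = b)
    (uniq : ∀ {T : C} (l l' : T ⟶ P), l ≫ p = l' ≫ p → l ≫ q = l' ≫ q → l = l') :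
    IsPullback p q f g where
  w := w
  isLimit' := ⟨Limits.PullbackCone.IsLimit.mk _
    (fun s => (ex s.fst s.snd s.condition).choose)
    (fun s => (ex s.fst s.snd s.condition).choose_spec.1)
    (fun s => (ex s.fst s.snd s.condition).choose_spec.2)
    (fun s _ h1 h2 => uniq _ _ (h1.trans (ex s.fst s.snd s.condition).choose_spec.1.symm)
      (h2.trans (ex s.fst s.snd s.condition).choose_spec.2.symm))⟩

namespace LocalicGroupoid

variable {G : LocalicGroupoid.{u}}

/-- The action of a groupoid on itself by left translations. -/
def translation (G : LocalicGroupoid.{u}) : G.LeftLocale where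
  X := G.G₁
  P := G.G₂
  p := G.d
  fst := G.fst
  snd := G.snd
  isPullback := G.isPullback
  act := G.m
  act_p := G.m_d
  assoc g h x hgh hhx := (G.assoc g h x hgh hhx).symm
  unit_act := G.u_m

namespace LeftLocale

variable (L : G.LeftLocale) {Z T : Locale.{u}}

/-- The result `g · x` of acting on generalized elements. -/
noncomputable def smul (g : Z ⟶ G.G₁) (x : Z ⟶ L.X) (h : g ≫ G.r = x ≫ L.p) : Z ⟶ L.X :=
  L.isPullback.lift g x h ≫ L.act

/-- The product of generalized elements. -/
noncomputable abbrev _root_.LocalicGroupoid.mul (g h : Z ⟶ G.G₁) (w : g ≫ G.r = h ≫ G.d) :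
    Z ⟶ G.G₁ :=
  G.translation.smul g h w

theorem smul_congr {g g' : Z ⟶ G.G₁} {x x' : Z ⟶ L.X} (hg : g = g') (hx : x = x')
    (h : g ≫ G.r = x ≫ L.p) (h' : g' ≫ G.r = x' ≫ L.p) : L.smul g x h = L.smul g' x' h' := by
  subst hg hx
  rfl

/-- Naturality in the stage `Z`, which allows identities of maps to be computed on generalized
elements. -/
theorem comp_smul (k : T ⟶ Z) (g : Z ⟶ G.G₁) (x : Z ⟶ L.X) (h : g ≫ G.r = x ≫ L.p) :
    k ≫ L.smul g x h = L.smul (k ≫ g) (k ≫ x) (by simp [h]) := by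
  unfold smul
  rw [← Category.assoc]
  congr 1
  apply L.isPullback.hom_ext <;> simp

theorem comp_act (l : Z ⟶ L.P) :
    l ≫ L.act = L.smul (l ≫ L.fst) (l ≫ L.snd) (by simp [L.isPullback.w]) := by
  unfold smul
  congr 1
  apply L.isPullback.hom_ext <;> simp

theorem smul_p (g : Z ⟶ G.G₁) (x : Z ⟶ L.X) (h : g ≫ G.r = x ≫ L.p) :
    L.smul g x h ≫ L.p = g ≫ G.d := by
  simp [smul, L.act_p]

theorem _root_.LocalicGroupoid.mul_d (g h : Z ⟶ G.G₁) (w : g ≫ G.r = h ≫ G.d) :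
    G.mul g h w ≫ G.d = g ≫ G.d :=
  G.translation.smul_p g h w

theorem _root_.LocalicGroupoid.mul_r (g h : Z ⟶ G.G₁) (w : g ≫ G.r = h ≫ G.d) :
    G.mul g h w ≫ G.r = h ≫ G.r := by
  change (G.isPullback.lift g h w ≫ G.m) ≫ G.r = _
  simp [G.m_r]

theorem smul_smul (g h : Z ⟶ G.G₁) (x : Z ⟶ L.X) (hgh : g ≫ G.r = h ≫ G.d)
    (hhx : h ≫ G.r = x ≫ L.p) :
    L.smul g (L.smul h x hhx) (by rw [smul_p, hgh]) =
      L.smul (G.mul g h hgh) x (by rw [mul_r, hhx]) :=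
  L.assoc g h x hgh hhx

theorem unit_smul (x : Z ⟶ L.X) (e : Z ⟶ G.G₁) (he : e = x ≫ L.p ≫ G.u)
    (h : e ≫ G.r = x ≫ L.p) : L.smul e x h = x := by
  subst he
  have := congrArg (x ≫ ·) L.unit_act
  rw [← smul, comp_smul] at this
  simpa using this

theorem _root_.LocalicGroupoid.inv_mul_self (g : Z ⟶ G.G₁) :
    G.mul (g ≫ G.i) g (by simp [G.i_r]) = g ≫ G.r ≫ G.u := by
  have := congrArg (g ≫ ·) G.inv_mul
  rw [← this]
  refine Eq.trans ?_ (G.translation.comp_smul g G.i (𝟙 G.G₁) (by simp [G.i_r, translation])).symm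
  exact smul_congr _ rfl (Category.comp_id g).symm _ _

theorem _root_.LocalicGroupoid.mul_inv_self (g : Z ⟶ G.G₁) :
    G.mul g (g ≫ G.i) (by simp [G.i_d]) = g ≫ G.d ≫ G.u := by
  have := congrArg (g ≫ ·) G.mul_inv
  rw [← this]
  refine Eq.trans ?_ (G.translation.comp_smul g (𝟙 G.G₁) G.i (by simp [G.i_d, translation])).symm
  exact smul_congr _ (Category.comp_id g).symm rfl _ _

theorem _root_.LocalicGroupoid.mul_unit (g e : Z ⟶ G.G₁) (he : e = g ≫ G.r ≫ G.u)
    (h : g ≫ G.r = e ≫ G.d) : G.mul g e h = g := by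
  subst he
  have := congrArg (g ≫ ·) G.m_u
  have h2 := G.translation.comp_smul g (𝟙 G.G₁) (G.r ≫ G.u) (by simp [G.u_d, translation])
  refine Eq.trans ?_ (h2.symm.trans (this.trans (Category.comp_id g)))
  exact smul_congr _ (Category.comp_id g).symm rfl _ _

theorem inv_smul_smul (g : Z ⟶ G.G₁) (x : Z ⟶ L.X) (h : g ≫ G.r = x ≫ L.p) :
    L.smul (g ≫ G.i) (L.smul g x h) (by simp [smul_p, G.i_r]) = x := by
  rw [L.smul_smul (g ≫ G.i) g x (by simp [G.i_r]) h]
  refine L.unit_smul x _ ?_ _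
  rw [inv_mul_self, ← Category.assoc, h, Category.assoc]

theorem smul_inv_smul (g : Z ⟶ G.G₁) (x : Z ⟶ L.X) (h : g ≫ G.d = x ≫ L.p) :
    L.smul g (L.smul (g ≫ G.i) x (by simp [h, G.i_r])) (by simp [smul_p, G.i_d]) = x := by
  rw [L.smul_smul g (g ≫ G.i) x (by simp [G.i_d]) (by simp [h, G.i_r])]
  refine L.unit_smul x _ ?_ _
  rw [mul_inv_self, ← Category.assoc, h, Category.assoc]

theorem _root_.LocalicGroupoid.comp_m (l : Z ⟶ G.G₂) :
    l ≫ G.m = G.mul (l ≫ G.fst) (l ≫ G.snd) (by simp [G.isPullback.w]) :=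
  G.translation.comp_act l

/-- Cancellation gives `(g⁻¹)⁻¹(g⁻¹g) = g`, and `g⁻¹g` is a unit, so the left side is `(g⁻¹)⁻¹`. -/
theorem _root_.LocalicGroupoid.i_i : G.i ≫ G.i = 𝟙 G.G₁ := by
  have h1 := G.translation.inv_smul_smul G.i (𝟙 G.G₁) (by simp [G.i_r, translation])
  have h2 := G.inv_mul_self (𝟙 G.G₁)
  simp only [Category.id_comp] at h2
  have h3 : G.translation.smul (G.i) (𝟙 G.G₁) (by simp [G.i_r, translation]) = G.r ≫ G.u := h2
  simp only [h3] at h1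
  rw [← h1]
  refine (G.mul_unit _ _ ?_ _).symm
  simp [reassoc_of% G.i_r, reassoc_of% G.i_d]

/-- A pair `(g, y)` over `G₀` comes from exactly one point, `(g, g⁻¹y)`. This is what makes `act`
open when `d` is. -/
theorem isPullback_fst_act : IsPullback L.fst L.act G.d L.p :=
  isPullback_of_elements L.act_p.symm
    (fun a b h => ⟨L.isPullback.lift a (L.smul (a ≫ G.i) b (by simp [h, G.i_r]))
      (by simp [smul_p, G.i_d]), by simp, by simpa [smul] using L.smul_inv_smul a b h⟩)
    (fun l l' h1 h2 => by
      refine L.isPullback.hom_ext h1 ?_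
      rw [L.comp_act, L.comp_act l'] at h2
      rw [← L.inv_smul_smul (l ≫ L.fst) (l ≫ L.snd) (by simp [L.isPullback.w]),
        ← L.inv_smul_smul (l' ≫ L.fst) (l' ≫ L.snd) (by simp [L.isPullback.w])]
      exact L.smul_congr (by rw [h1]) h2 _ _)

/-! ### The locale of triples `(g, h, x)` and its pullback squares. -/

section Triples

variable {L} {W : Locale.{u}} {wG : W ⟶ G.G₂} {wP : W ⟶ L.P}
  (hW : IsPullback wG wP G.snd L.fst)

include hW

theorem triple_mul_aux : (wG ≫ G.m) ≫ G.r = (wP ≫ L.snd) ≫ L.p := by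
  rw [Category.assoc, G.m_r, reassoc_of% hW.w, L.isPullback.w, Category.assoc]

theorem triple_act_aux : (wG ≫ G.fst) ≫ G.r = (wP ≫ L.act) ≫ L.p := by
  rw [Category.assoc, G.isPullback.w, reassoc_of% hW.w, Category.assoc, L.act_p]

/-- The map `(g, h, x) ↦ (gh, x)`. -/
noncomputable def tripleMul : W ⟶ L.P :=
  L.isPullback.lift (wG ≫ G.m) (wP ≫ L.snd) (triple_mul_aux hW)

/-- The map `(g, h, x) ↦ (g, hx)`. -/
noncomputable def tripleAct : W ⟶ L.P :=
  L.isPullback.lift (wG ≫ G.fst) (wP ≫ L.act) (triple_act_aux hW)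

theorem tripleMul_fst : tripleMul hW ≫ L.fst = wG ≫ G.m := L.isPullback.lift_fst _ _ _

theorem tripleMul_snd : tripleMul hW ≫ L.snd = wP ≫ L.snd := L.isPullback.lift_snd _ _ _

theorem tripleAct_fst : tripleAct hW ≫ L.fst = wG ≫ G.fst := L.isPullback.lift_fst _ _ _

theorem tripleAct_snd : tripleAct hW ≫ L.snd = wP ≫ L.act := L.isPullback.lift_snd _ _ _

theorem tripleMul_act : tripleMul hW ≫ L.act = tripleAct hW ≫ L.act := by
  have h := L.smul_smul (wG ≫ G.fst) (wG ≫ G.snd) (wP ≫ L.snd) (by simp [G.isPullback.w])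
    (by simp only [hW.w, Category.assoc, L.isPullback.w])
  rw [L.comp_act, L.comp_act (tripleAct hW)]
  simp only [tripleMul_fst, tripleMul_snd, tripleAct_fst, tripleAct_snd]
  simp only [L.comp_act wP, comp_m wG, ← hW.w]
  exact h.symm

/-- A triple amounts to a pair `(g, h)` and a pair `(k, x)` with `k = gh`. -/
theorem isPullback_tripleMul : IsPullback wG (tripleMul hW) G.m L.fst :=
  isPullback_of_elements (tripleMul_fst hW).symm
    (fun a b h => by
      refine ⟨hW.lift a (L.isPullback.lift (a ≫ G.snd) (b ≫ L.snd) ?_) (L.isPullback.lift_fst _ _ _).symm,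
        hW.lift_fst _ _ _, ?_⟩
      · rw [Category.assoc, ← G.m_r, reassoc_of% h, L.isPullback.w, Category.assoc]
      · apply L.isPullback.hom_ext
        · rw [Category.assoc, tripleMul_fst, hW.lift_fst_assoc, h]
        · rw [Category.assoc, tripleMul_snd, hW.lift_snd_assoc, L.isPullback.lift_snd])
    (fun l l' h1 h2 => by
      refine hW.hom_ext h1 (L.isPullback.hom_ext ?_ ?_)
      · simp only [Category.assoc, ← hW.w, reassoc_of% h1]
      · simpa only [Category.assoc, tripleMul_snd] using congrArg (· ≫ L.snd) h2)

/-- A triple amounts to a pair `(h, x)` and a pair `(g, y)` with `y = hx`. -/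
theorem isPullback_tripleAct : IsPullback wP (tripleAct hW) L.act L.snd :=
  isPullback_of_elements (tripleAct_snd hW).symm
    (fun b c h => by
      refine ⟨hW.lift (G.isPullback.lift (c ≫ L.fst) (b ≫ L.fst) ?_) b (G.isPullback.lift_snd _ _ _),
        hW.lift_snd _ _ _, ?_⟩
      · rw [Category.assoc, L.isPullback.w, ← reassoc_of% h, L.act_p, Category.assoc]
      · apply L.isPullback.hom_ext
        · rw [Category.assoc, tripleAct_fst, hW.lift_fst_assoc, G.isPullback.lift_fst]
        · rw [Category.assoc, tripleAct_snd, hW.lift_snd_assoc, h])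
    (fun l l' h1 h2 => by
      refine hW.hom_ext (G.isPullback.hom_ext ?_ ?_) h1
      · simpa only [Category.assoc, tripleAct_fst] using congrArg (· ≫ L.fst) h2
      · simp only [Category.assoc, hW.w, reassoc_of% h1])

/-- Given `kx = gy`, the triple is `(g, g⁻¹k, x)`. Here the inverse of the groupoid is essential. -/
theorem isPullback_tripleMul_tripleAct :
    IsPullback (tripleMul hW) (tripleAct hW) L.act L.act :=
  isPullback_of_elements (tripleMul_act hW)
    (fun b c h => by
      have hd : (c ≫ L.fst) ≫ G.d = (b ≫ L.fst) ≫ G.d := by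
        simp only [Category.assoc, ← L.act_p, reassoc_of% h]
      have hk : ((c ≫ L.fst) ≫ G.i) ≫ G.r = (b ≫ L.fst) ≫ G.d := by
        rw [Category.assoc, G.i_r, hd]
      have hc : (c ≫ L.fst) ≫ G.r = (c ≫ L.snd) ≫ L.p := by simp [L.isPullback.w]
      have hb : (b ≫ L.fst) ≫ G.r = (b ≫ L.snd) ≫ L.p := by simp [L.isPullback.w]
      let k : _ ⟶ G.G₁ := G.mul ((c ≫ L.fst) ≫ G.i) (b ≫ L.fst) hk
      have k1 : (c ≫ L.fst) ≫ G.r = k ≫ G.d := by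
        rw [mul_d, Category.assoc (c ≫ L.fst), G.i_d]
      have k2 : k ≫ G.r = (b ≫ L.snd) ≫ L.p := by rw [mul_r, hb]
      refine ⟨hW.lift (G.isPullback.lift (c ≫ L.fst) k k1) (L.isPullback.lift k (b ≫ L.snd) k2)
        (by simp), ?_, ?_⟩
      · apply L.isPullback.hom_ext
        · rw [Category.assoc, tripleMul_fst, hW.lift_fst_assoc]
          exact G.translation.smul_inv_smul (c ≫ L.fst) (b ≫ L.fst) hd
        · rw [Category.assoc, tripleMul_snd, hW.lift_snd_assoc, L.isPullback.lift_snd]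
      · apply L.isPullback.hom_ext
        · rw [Category.assoc, tripleAct_fst, hW.lift_fst_assoc, G.isPullback.lift_fst]
        · rw [Category.assoc, tripleAct_snd, hW.lift_snd_assoc]
          -- With `b = (k', x)` and `c = (g, y)`: `(g⁻¹k')x = g⁻¹(k'x) = g⁻¹(gy) = y`.
          refine (L.smul_smul ((c ≫ L.fst) ≫ G.i) (b ≫ L.fst) (b ≫ L.snd) hk hb).symm.trans ?_
          rw [L.comp_act, L.comp_act c] at h
          simp only [h]
          exact L.inv_smul_smul _ _ hc)
    (fun l l' h1 h2 => by
      have e1 : l ≫ wG ≫ G.fst = l' ≫ wG ≫ G.fst := by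
        simpa only [Category.assoc, tripleAct_fst] using congrArg (· ≫ L.fst) h2
      have e2 : l ≫ wG ≫ G.m = l' ≫ wG ≫ G.m := by
        simpa only [Category.assoc, tripleMul_fst] using congrArg (· ≫ L.fst) h1
      -- A composable pair `(g, h)` is determined by `g` and `gh`: this is `isPullback_fst_act` for
      -- translations.
      have e3 : l ≫ wG = l' ≫ wG := by
        apply G.translation.isPullback_fst_act.hom_ext
        · exact (Category.assoc _ _ _).trans (e1.trans (Category.assoc _ _ _).symm)
        · exact (Category.assoc _ _ _).trans (e2.trans (Category.assoc _ _ _).symm)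
      refine hW.hom_ext e3 (L.isPullback.hom_ext ?_ ?_)
      · simp only [Category.assoc, ← hW.w, reassoc_of% e3]
      · simpa only [Category.assoc, tripleMul_snd] using congrArg (· ≫ L.snd) h1)

end Triples

end LeftLocale

end LocalicGroupoid

/-! ### The action of the quantale of an open groupoid -/

namespace LocalicGroupoid

variable {G : LocalicGroupoid.{u}}

theorem IsOpenGroupoid.open_d (hG : G.IsOpenGroupoid) : IsOpenLocaleMap G.d := hG

theorem dirIm_i (x : G.G₁.unop) : dirIm G.i x = invIm G.i x := dirIm_of_inverse i_i i_i x

theorem invIm_i_i (x : G.G₁.unop) : invIm G.i (invIm G.i x) = x := by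
  rw [← invIm_comp, i_i, invIm_id]

theorem IsOpenGroupoid.open_r (hG : G.IsOpenGroupoid) : IsOpenLocaleMap G.r := by
  rw [← G.i_d]
  exact (isOpenLocaleMap_of_inverse i_i i_i).comp hG

theorem IsOpenGroupoid.dirIm_r (hG : G.IsOpenGroupoid) (q : G.G₁.unop) :
    dirIm G.r q = dirIm G.d (invIm G.i q) := by
  rw [← dirIm_i, ← (isOpenLocaleMap_of_inverse i_i i_i).dirIm_comp hG, G.i_d]

namespace LeftLocale

variable (L : G.LeftLocale)

theorem open_act (hG : G.IsOpenGroupoid) : IsOpenLocaleMap L.act :=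
  isOpen_snd L.isPullback_fst_act hG

/-- The action `q · x = act_!(q ⊗ x)` of the quantale of the groupoid. -/
def qact (q : G.G₁.unop) (x : L.X.unop) : L.X.unop :=
  dirIm L.act (invIm L.fst q ⊓ invIm L.snd x)

theorem invIm_fst_d (a : G.G₀.unop) :
    invIm L.fst (invIm G.d a) = invIm L.act (invIm L.p a) :=
  invIm_congr L.act_p.symm a

theorem invIm_fst_r (a : G.G₀.unop) :
    invIm L.fst (invIm G.r a) = invIm L.snd (invIm L.p a) :=
  invIm_congr L.isPullback.w a

/-- The map `x ↦ (1, x)`. -/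
noncomputable def unitSection : L.X ⟶ L.P :=
  L.isPullback.lift (L.p ≫ G.u) (𝟙 L.X) (by simp [G.u_r])

theorem unitSection_act : L.unitSection ≫ L.act = 𝟙 L.X := L.unit_act

theorem unitSection_tmul (q : G.G₁.unop) (x : L.X.unop) :
    invIm L.unitSection (invIm L.fst q ⊓ invIm L.snd x) = invIm L.p (invIm G.u q) ⊓ x := by
  rw [map_inf, ← invIm_comp, ← invIm_comp, unitSection, L.isPullback.lift_fst,
    L.isPullback.lift_snd, invIm_comp, invIm_id]

theorem pullbackIso_act_sSup (S : Set L.X.unop) :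
    pullbackIso L.isPullback (invIm L.act (sSup S)) =
      ⨆ x ∈ S, pullbackIso L.isPullback (invIm L.act x) := by
  rw [sSup_eq_iSup]
  simp only [map_iSup]

variable (hG : G.IsOpenGroupoid)
include hG

theorem dirIm_act_fst (q : G.G₁.unop) :
    dirIm L.act (invIm L.fst q) = invIm L.p (dirIm G.d q) :=
  dirIm_snd_fst L.isPullback_fst_act hG q

theorem qact_le_iff {q : G.G₁.unop} {x y : L.X.unop} :
    L.qact q x ≤ y ↔ invIm L.fst q ⊓ invIm L.snd x ≤ invIm L.act y :=
  (L.open_act hG).dirIm_le_iff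

theorem qact_sSup_left (S : Set G.G₁.unop) (x : L.X.unop) :
    L.qact (sSup S) x = ⨆ q ∈ S, L.qact q x := by
  unfold qact
  simp only [sSup_eq_iSup, map_iSup, iSup_inf_eq, (L.open_act hG).dirIm_iSup]

theorem qact_sSup_right (q : G.G₁.unop) (S : Set L.X.unop) :
    L.qact q (sSup S) = ⨆ x ∈ S, L.qact q x := by
  unfold qact
  simp only [sSup_eq_iSup, map_iSup, inf_iSup_eq, (L.open_act hG).dirIm_iSup]

theorem qact_mono {q q' : G.G₁.unop} {x x' : L.X.unop} (hq : q ≤ q') (hx : x ≤ x') :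
    L.qact q x ≤ L.qact q' x' :=
  (L.open_act hG).dirIm_mono (inf_le_inf (OrderHomClass.mono _ hq) (OrderHomClass.mono _ hx))

theorem qact_lres (a : G.G₀.unop) (q : G.G₁.unop) (x : L.X.unop) :
    L.qact (invIm G.d a ⊓ q) x = invIm L.p a ⊓ L.qact q x := by
  unfold qact
  rw [map_inf, invIm_fst_d, inf_assoc, (L.open_act hG).dirIm_invIm_inf]

omit hG in
theorem qact_rres (q : G.G₁.unop) (a : G.G₀.unop) (x : L.X.unop) :
    L.qact (q ⊓ invIm G.r a) x = L.qact q (invIm L.p a ⊓ x) := by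
  unfold qact
  rw [map_inf, map_inf, invIm_fst_r, inf_assoc]

theorem qact_top_right (q : G.G₁.unop) : L.qact q ⊤ = invIm L.p (dirIm G.d q) := by
  unfold qact
  rw [map_top, inf_top_eq, L.dirIm_act_fst hG]

/-- Beck–Chevalley for two squares of triples, followed by Frobenius, rewrites each side as the
direct image of `q ⊗ q' ⊗ x` along `(g, h, x) ↦ (gh)x = g(hx)`. -/
theorem qact_qact (q q' : G.G₁.unop) (x : L.X.unop) :
    L.qact (G.translation.qact q q') x = L.qact q (L.qact q' x) := by
  have hW := isPullback_pullbackLocale G.snd L.fst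
  have hm := G.translation.open_act hG
  have h1 := isPullback_tripleMul hW
  have h2 := isPullback_tripleAct hW
  have o1 : IsOpenLocaleMap (tripleMul hW) := isOpen_snd h1 hm
  have o2 : IsOpenLocaleMap (tripleAct hW) := isOpen_snd h2 (L.open_act hG)
  have e1 : ∀ t, invIm L.fst (dirIm G.m t) = _ := fun t => (dirIm_snd_fst h1 hm t).symm
  have e2 : ∀ t, invIm L.snd (dirIm L.act t) = _ :=
    fun t => (dirIm_snd_fst h2 (L.open_act hG) t).symm
  change dirIm L.act (invIm L.fst (dirIm G.m (invIm G.fst q ⊓ invIm G.snd q')) ⊓ invIm L.snd x) =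
    dirIm L.act (invIm L.fst q ⊓
      invIm L.snd (dirIm L.act (invIm L.fst q' ⊓ invIm L.snd x)))
  rw [e1, e2, ← o1.dirIm_inf_invIm, ← o2.dirIm_invIm_inf, ← o1.dirIm_comp (L.open_act hG),
    ← o2.dirIm_comp (L.open_act hG), tripleMul_act hW]
  congr 1
  rw [map_inf, map_inf, ← invIm_comp, ← invIm_comp, ← invIm_comp, ← invIm_comp, ← invIm_comp,
    ← invIm_comp, tripleMul_snd, tripleAct_fst, hW.w, inf_assoc]

/-- Pulling `act^* x` back along the section `x ↦ (1, x)` returns `x`; expanding `act^* x` into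
rectangles first gives the join. For translations this is the unit law of the quantale, for a bundle
it is (Q2). -/
theorem iSup_unit (x : L.X.unop) :
    ⨆ (q : G.G₁.unop) (y : L.X.unop) (_ : L.qact q y ≤ x), invIm L.p (invIm G.u q) ⊓ y = x := by
  have h : invIm L.unitSection (invIm L.act x) = x := by
    rw [← invIm_comp, unitSection_act, invIm_id]
  rw [eq_iSup_of_isPullback L.isPullback (invIm L.act x)] at h
  simp only [map_iSup, unitSection_tmul, ← L.qact_le_iff hG] at h
  exact h

/-- The right side is the join defining `α_*`, which thus inherits preservation of joins from the
frame homomorphism `act^*`. -/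
theorem pullbackIso_act (x : L.X.unop) :
    pullbackIso L.isPullback (invIm L.act x) =
      ⨆ (q : G.G₁.unop) (y : L.X.unop) (_ : L.qact q y ≤ x), ftmul (invIm G.r) (invIm L.p) q y := by
  conv_lhs => rw [eq_iSup_of_isPullback L.isPullback (invIm L.act x)]
  simp only [OrderIso.map_iSup, pullbackIso_tmul, ← L.qact_le_iff hG]

theorem isBalanced_qact :
    SupTensor.IsBalanced (fun (q : G.G₁.unop) (a : G.G₀.unop) => q ⊓ invIm G.r a)
      (fun (a : G.G₀.unop) (x : L.X.unop) => invIm L.p a ⊓ x) L.qact where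
  sSup_left := L.qact_sSup_left hG
  sSup_right := L.qact_sSup_right hG
  balanced := L.qact_rres

theorem lift_qact_pullbackIso (t : L.P.unop) :
    SupTensor.lift L.qact (pullbackIso L.isPullback t) = dirIm L.act t := by
  rw [eq_iSup_of_isPullback L.isPullback t]
  simp only [OrderIso.map_iSup, (L.open_act hG).dirIm_iSup, (L.isBalanced_qact hG).gc_lift.l_iSup]
  refine iSup_congr fun q => iSup_congr fun x => iSup_congr fun _ => ?_
  exact (congrArg _ (pullbackIso_tmul L.isPullback q x)).trans
    ((L.isBalanced_qact hG).lift_tmul q x)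

/-- The map induced by the action is `act_!` under the identification of `P` with the tensor
product, so its right adjoint is `act^*`. -/
theorem gc_lift_qact :
    GaloisConnection
      (SupTensor.lift L.qact : FrameTensor (invIm G.r) (invIm L.p) → L.X.unop)
      (fun x => pullbackIso L.isPullback (invIm L.act x)) := fun t x => by
  obtain ⟨s, rfl⟩ := (pullbackIso L.isPullback).surjective t
  rw [L.lift_qact_pullbackIso hG, (pullbackIso L.isPullback).le_iff_le]
  exact (L.open_act hG).dirIm_le_iff

end LeftLocale

/-! ### The quantale of an open groupoid -/

theorem quantale_mul (x y : G.G₁.unop) : G.quantale.mul x y = G.translation.qact x y := rfl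

theorem quantale_star (x : G.G₁.unop) : G.quantale.star x = invIm G.i x := dirIm_i x

theorem invIm_i_d (a : G.G₀.unop) : invIm G.i (invIm G.d a) = invIm G.r a := invIm_congr G.i_d a

theorem invIm_i_r (a : G.G₀.unop) : invIm G.i (invIm G.r a) = invIm G.d a := invIm_congr G.i_r a

theorem isBimodule_quantale : G.quantale.IsBimodule where
  lres_sSup_left S q := by
    change invIm G.d (sSup S) ⊓ q = ⨆ a ∈ S, invIm G.d a ⊓ q
    simp only [sSup_eq_iSup, map_iSup, iSup_inf_eq]
  lres_sSup_right a S := inf_sSup_eq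
  lres_inf a b q := by
    change invIm G.d (a ⊓ b) ⊓ q = invIm G.d a ⊓ (invIm G.d b ⊓ q)
    rw [map_inf, inf_assoc]
  lres_top q := by
    change invIm G.d ⊤ ⊓ q = q
    rw [map_top, top_inf_eq]
  rres_sSup_left S a := sSup_inf_eq
  rres_sSup_right q S := by
    change q ⊓ invIm G.r (sSup S) = ⨆ a ∈ S, q ⊓ invIm G.r a
    simp only [sSup_eq_iSup, map_iSup, inf_iSup_eq]
  rres_inf q a b := by
    change q ⊓ invIm G.r (a ⊓ b) = (q ⊓ invIm G.r a) ⊓ invIm G.r b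
    rw [map_inf, inf_assoc]
  rres_top q := by
    change q ⊓ invIm G.r ⊤ = q
    rw [map_top, inf_top_eq]
  rres_lres a b q := inf_assoc _ _ _

theorem IsOpenGroupoid.isBimoduleQuantale (hG : G.IsOpenGroupoid) : G.quantale.IsBimoduleQuantale where
  toIsBimodule := isBimodule_quantale
  mul_assoc x y z := G.translation.qact_qact hG x y z
  mul_sSup x S := G.translation.qact_sSup_right hG x S
  sSup_mul S y := G.translation.qact_sSup_left hG S y
  lres_mul a x y := G.translation.qact_lres hG a x y
  rres_mul x a y := G.translation.qact_rres x a y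
  mul_rres x y a := by
    change dirIm G.m (invIm G.fst x ⊓ invIm G.snd y) ⊓ invIm G.r a =
      dirIm G.m (invIm G.fst x ⊓ invIm G.snd (y ⊓ invIm G.r a))
    have hm : IsOpenLocaleMap G.m := G.translation.open_act hG
    rw [← hm.dirIm_inf_invIm, ← invIm_comp, G.m_r, invIm_comp, map_inf, inf_assoc]

/-- The map `(g, h) ↦ (h⁻¹, g⁻¹)`. -/
noncomputable def flipInv (G : LocalicGroupoid.{u}) : G.G₂ ⟶ G.G₂ :=
  G.isPullback.lift (G.snd ≫ G.i) (G.fst ≫ G.i) (by simp [G.i_d, G.i_r, G.isPullback.w])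

theorem flipInv_fst : G.flipInv ≫ G.fst = G.snd ≫ G.i := G.isPullback.lift_fst _ _ _

theorem flipInv_snd : G.flipInv ≫ G.snd = G.fst ≫ G.i := G.isPullback.lift_snd _ _ _

theorem flipInv_flipInv : G.flipInv ≫ G.flipInv = 𝟙 G.G₂ := by
  apply G.isPullback.hom_ext <;>
  simp only [Category.assoc, flipInv_fst, flipInv_snd, reassoc_of% flipInv_fst,
    reassoc_of% flipInv_snd, i_i, Category.comp_id, Category.id_comp]

theorem eq_inv_of_mul_eq_unit {Z : Locale.{u}} (g h : Z ⟶ G.G₁) (w : g ≫ G.r = h ≫ G.d)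
    (e : G.mul g h w = g ≫ G.d ≫ G.u) : h = g ≫ G.i := by
  have h1 := G.translation.inv_smul_smul g h w
  rw [← h1]
  refine (G.translation.smul_congr rfl e _ (by simp [translation, G.i_r, G.u_d])).trans ?_
  exact G.mul_unit _ _ (by simp [reassoc_of% G.i_r]) _

/-- `(gh)(h⁻¹g⁻¹) = g(h(h⁻¹g⁻¹)) = gg⁻¹` is a unit, and right inverses are unique. -/
theorem flipInv_m : G.flipInv ≫ G.m = G.m ≫ G.i := by
  have w := G.isPullback.w
  have w' : (G.snd ≫ G.i) ≫ G.r = (G.fst ≫ G.i) ≫ G.d := by simp [G.i_d, G.i_r, w]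
  have e0 : G.flipInv ≫ G.m = G.mul (G.snd ≫ G.i) (G.fst ≫ G.i) w' :=
    (G.translation.comp_act G.flipInv).trans
      (G.translation.smul_congr flipInv_fst flipInv_snd _ _)
  have e1 : G.m = G.mul G.fst G.snd w :=
    (Category.id_comp _).symm.trans ((comp_m (𝟙 G.G₂)).trans
      (G.translation.smul_congr (Category.id_comp _) (Category.id_comp _) _ _))
  have w1 : G.snd ≫ G.r = G.mul (G.snd ≫ G.i) (G.fst ≫ G.i) w' ≫ G.d := by
    rw [mul_d, Category.assoc, G.i_d]
  have w2 : G.fst ≫ G.r = (G.fst ≫ G.i) ≫ G.d := by rw [Category.assoc, G.i_d]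
  have w3 : G.mul G.fst G.snd w ≫ G.r = G.mul (G.snd ≫ G.i) (G.fst ≫ G.i) w' ≫ G.d :=
    (mul_r _ _ _).trans w1
  have w4 : G.m ≫ G.r = (G.flipInv ≫ G.m) ≫ G.d := by rw [e0, G.m_r, w1]
  have h3 : G.mul G.snd (G.mul (G.snd ≫ G.i) (G.fst ≫ G.i) w') w1 = G.fst ≫ G.i :=
    G.translation.smul_inv_smul G.snd (G.fst ≫ G.i) (w.symm.trans w2)
  refine eq_inv_of_mul_eq_unit G.m (G.flipInv ≫ G.m) w4 ?_
  refine (G.translation.smul_congr e1 e0 _ w3).trans ?_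
  refine (G.translation.smul_smul G.fst G.snd (G.mul (G.snd ≫ G.i) (G.fst ≫ G.i) w') w
    w1).symm.trans ?_
  refine (G.translation.smul_congr rfl h3 _ w2).trans ?_
  exact (mul_inv_self G.fst).trans (by rw [← Category.assoc, ← Category.assoc, G.m_d])

/-- The map `(g, h) ↦ (g⁻¹, gh)`. -/
noncomputable def shear (G : LocalicGroupoid.{u}) : G.G₂ ⟶ G.G₂ :=
  G.isPullback.lift (G.fst ≫ G.i) G.m (by simp [G.i_r, G.m_d])

theorem shear_m : G.shear ≫ G.m = G.snd := by
  refine (G.translation.comp_act G.shear).trans ?_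
  have h := G.translation.inv_smul_smul G.fst G.snd G.isPullback.w
  refine (G.translation.smul_congr (G.isPullback.lift_fst _ _ _)
    ((G.isPullback.lift_snd _ _ _).trans ?_) _ _).trans h
  exact (Category.id_comp _).symm.trans ((comp_m (𝟙 G.G₂)).trans
      (G.translation.smul_congr (Category.id_comp _) (Category.id_comp _) _ _))

theorem invIm_u_d (a : G.G₀.unop) : invIm G.u (invIm G.d a) = a := invIm_congr G.u_d a

theorem invIm_u_r (a : G.G₀.unop) : invIm G.u (invIm G.r a) = a := invIm_congr G.u_r a

theorem isReflexive_quantale : G.quantale.IsReflexive where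
  ups_lres a := by
    change invIm G.u (invIm G.d a ⊓ ⊤) = a
    rw [inf_top_eq, invIm_u_d]
  ups_rres a := by
    change invIm G.u (⊤ ⊓ invIm G.r a) = a
    rw [top_inf_eq, invIm_u_r]

/-- The map `g ↦ (g, g⁻¹)`. -/
noncomputable def invSection (G : LocalicGroupoid.{u}) : G.G₁ ⟶ G.G₂ :=
  G.isPullback.lift (𝟙 G.G₁) G.i (by simp [G.i_d])

theorem invSection_m : G.invSection ≫ G.m = G.d ≫ G.u := G.mul_inv

theorem invSection_tmul (x y : G.G₁.unop) :
    invIm G.invSection (invIm G.fst x ⊓ invIm G.snd y) = x ⊓ invIm G.i y := by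
  rw [map_inf, ← invIm_comp, ← invIm_comp, invSection, G.isPullback.lift_fst,
    G.isPullback.lift_snd, invIm_id]

section

variable (hG : G.IsOpenGroupoid)
include hG

theorem IsOpenGroupoid.isBased : G.quantale.IsBased where
  toIsBimoduleQuantale := hG.isBimoduleQuantale
  star_star x := by rw [quantale_star, quantale_star, invIm_i_i]
  star_mul x y := by
    rw [quantale_star, quantale_star, quantale_star, quantale_mul, quantale_mul]
    have hm : IsOpenLocaleMap G.m := G.translation.open_act hG
    have ho := isOpenLocaleMap_of_inverse (i_i (G := G)) i_i
    have hf := isOpenLocaleMap_of_inverse (flipInv_flipInv (G := G)) flipInv_flipInv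
    change invIm G.i (dirIm G.m (invIm G.fst x ⊓ invIm G.snd y)) =
      dirIm G.m (invIm G.fst (invIm G.i y) ⊓ invIm G.snd (invIm G.i x))
    -- For an involution, direct and inverse images agree, so both sides are direct images along the
    -- equal maps `G.m ≫ G.i` and `G.flipInv ≫ G.m`.
    rw [← dirIm_i, ← hm.dirIm_comp ho, ← flipInv_m, hf.dirIm_comp hm,
      dirIm_of_inverse flipInv_flipInv flipInv_flipInv, map_inf, ← invIm_comp, ← invIm_comp,
      ← invIm_comp, ← invIm_comp, flipInv_fst, flipInv_snd, inf_comm]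
  star_sSup S := by
    rw [quantale_star, sSup_eq_iSup]
    simp only [map_iSup, quantale_star]
  star_res a b x := by
    rw [quantale_star, quantale_star]
    change invIm G.i (invIm G.d a ⊓ (x ⊓ invIm G.r b)) =
      invIm G.d b ⊓ (invIm G.i x ⊓ invIm G.r a)
    rw [map_inf, map_inf, invIm_i_d, invIm_i_r, inf_comm, inf_comm (invIm G.i x), inf_assoc]

theorem IsOpenGroupoid.isQuantalFrame : G.quantale.IsQuantalFrame where
  toIsBased := hG.isBased
  lres_inf_elem _ _ _ := inf_assoc _ _ _
  inf_rres_elem m q a := by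
    change m ⊓ (q ⊓ invIm G.r a) = (q ⊓ m) ⊓ invIm G.r a
    rw [← inf_assoc, inf_comm m]

/-- Beck–Chevalley gives `d^* d_! x = m_!(fst^* x)`. After Frobenius the claim is pointwise: if `g ∈
x` and `gh ∈ y`, then `h = g⁻¹(gh)` lies in `x* y`, which is the unit of `m_!` pulled back along
`shear`. -/
theorem IsOpenGroupoid.invIm_supp_inf_le (x y : G.G₁.unop) :
    invIm G.d (dirIm G.d x) ⊓ y ≤
      G.translation.qact x (G.translation.qact (invIm G.i x) y) := by
  have hm : IsOpenLocaleMap G.m := G.translation.open_act hG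
  have h : dirIm G.m (invIm G.fst x) = _ := G.translation.dirIm_act_fst hG x
  change dirIm G.m _ = invIm G.d _ at h
  rw [← h, ← hm.dirIm_inf_invIm]
  refine hm.dirIm_mono (le_inf inf_le_left ?_)
  have h1 := OrderHomClass.mono (invIm G.shear)
    (hm.le_invIm_dirIm (invIm G.fst (invIm G.i x) ⊓ invIm G.snd y))
  rw [map_inf, ← invIm_comp, ← invIm_comp, ← invIm_comp, ← invIm_comp, shear_m] at h1
  have e1 : (G.shear ≫ G.fst) ≫ G.i = G.fst := by
    rw [shear, G.isPullback.lift_fst, Category.assoc, i_i, Category.comp_id]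
  have e2 : G.shear ≫ G.snd = G.m := G.isPullback.lift_snd _ _ _
  rw [e1, e2] at h1
  exact h1

theorem IsOpenGroupoid.isEquivariantSupport : G.quantale.IsEquivariantSupport where
  supp_sSup S := hG.open_d.dirIm_sSup S
  supp_top := hG.open_d.dirIm_top_of_surj (isSurjLocaleMap_of_section G.u_d)
  supp_le x y := by
    rw [hG.isBimoduleQuantale.mul_assoc, quantale_star]
    exact hG.invIm_supp_inf_le x y
  supp_self x := inf_eq_right.2 (hG.open_d.le_invIm_dirIm x)
  supp_lres a x := hG.open_d.dirIm_invIm_inf x a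

theorem IsOpenGroupoid.isMultiplicative : G.quantale.IsMultiplicative :=
  ⟨_, G.translation.gc_lift_qact hG, G.translation.pullbackIso_act_sSup⟩

/-- Since `gg⁻¹` is the unit at `d g`, the left side is `m^* a` pulled back along `g ↦ (g, g⁻¹)`,
and `m^* a` can be expanded into rectangles. -/
theorem IsOpenGroupoid.invIm_d_u (a : G.G₁.unop) :
    invIm G.d (invIm G.u a) =
      ⨆ (x : G.G₁.unop) (_ : G.translation.qact x (invIm G.i x) ≤ a), x := by
  have h : invIm G.invSection (invIm G.m a) = invIm G.d (invIm G.u a) := invIm_congr invSection_m a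
  refine le_antisymm ?_ (iSup₂_le fun x hx => ?_)
  · rw [← h, eq_iSup_of_isPullback G.isPullback (invIm G.m a)]
    simp only [map_iSup, invSection_tmul]
    refine iSup_le fun x => iSup_le fun y => iSup_le fun hxy => ?_
    -- The witness `z = x ∧ y*` satisfies `z ≤ x` and `z* ≤ y`, hence `z z* ≤ xy ≤ a`.
    refine le_iSup₂_of_le (x ⊓ invIm G.i y) ?_ le_rfl
    refine (G.translation.qact_mono hG inf_le_left ?_).trans
      ((G.translation.qact_le_iff hG).2 hxy)
    rw [map_inf, invIm_i_i]
    exact inf_le_right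
  · have h1 := OrderHomClass.mono (invIm G.invSection) ((G.translation.qact_le_iff hG).1 hx)
    refine le_trans ?_ (h1.trans h.le)
    refine le_trans ?_ (invSection_tmul x (invIm G.i x)).ge
    rw [invIm_i_i, inf_idem]

theorem IsOpenGroupoid.isGroupoidQuantale : G.quantale.IsGroupoidQuantale where
  quantalFrame := hG.isQuantalFrame
  support := hG.isEquivariantSupport
  reflexive := isReflexive_quantale
  multiplicative := hG.isMultiplicative
  unit_laws := G.translation.iSup_unit hG
  inverse_laws a := by
    change invIm G.d (invIm G.u a) ⊓ ⊤ = _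
    rw [inf_top_eq, hG.invIm_d_u]
    simp only [quantale_star]
    rfl

end

end LocalicGroupoid

/-! ### The inner product of a principal bundle -/

namespace LocalicGroupoid

variable {G : LocalicGroupoid.{u}}

namespace LeftLocale

variable (L : G.LeftLocale)

/-- The element `fst_!(act^*(x) ∧ snd^*(y))` of those `g` that move a point of `y` into `x`. -/
def transporter (x y : L.X.unop) : G.G₁.unop :=
  dirIm L.fst (invIm L.act x ⊓ invIm L.snd y)

/-- The map `(g, x) ↦ (g⁻¹, gx)`. -/
noncomputable def swap : L.P ⟶ L.P :=
  L.isPullback.lift (L.fst ≫ G.i) L.act (by simp [G.i_r, L.act_p])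

theorem swap_fst : L.swap ≫ L.fst = L.fst ≫ G.i := L.isPullback.lift_fst _ _ _

theorem swap_snd : L.swap ≫ L.snd = L.act := L.isPullback.lift_snd _ _ _

theorem swap_act : L.swap ≫ L.act = L.snd := by
  have h := L.inv_smul_smul L.fst L.snd L.isPullback.w
  refine (L.comp_act L.swap).trans ((L.smul_congr L.swap_fst (L.swap_snd.trans ?_) _ _).trans h)
  exact (Category.id_comp _).symm.trans ((L.comp_act (𝟙 L.P)).trans
    (L.smul_congr (Category.id_comp _) (Category.id_comp _) _ _))

theorem swap_swap : L.swap ≫ L.swap = 𝟙 L.P := by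
  apply L.isPullback.hom_ext
  · rw [Category.assoc, swap_fst, ← Category.assoc, swap_fst, Category.assoc, i_i,
      Category.comp_id, Category.id_comp]
  · rw [Category.assoc, swap_snd, swap_act, Category.id_comp]

variable (hp : IsOpenLocaleMap L.p)
include hp

theorem open_fst : IsOpenLocaleMap L.fst := isOpen_fst L.isPullback hp

/-- The involution `swap` exchanges `act` and `snd` and inverts `fst`. -/
theorem transporter_comm (x y : L.X.unop) :
    L.transporter x y = invIm G.i (L.transporter y x) := by
  have hf := L.open_fst hp
  have hi := isOpenLocaleMap_of_inverse (i_i (G := G)) i_i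
  have hs := isOpenLocaleMap_of_inverse L.swap_swap L.swap_swap
  unfold transporter
  rw [← dirIm_i, ← hf.dirIm_comp hi, ← swap_fst, hs.dirIm_comp hf,
    dirIm_of_inverse L.swap_swap L.swap_swap, map_inf, ← invIm_comp, ← invIm_comp, swap_act,
    swap_snd, inf_comm]

theorem transporter_sSup (S : Set L.X.unop) (y : L.X.unop) :
    L.transporter (sSup S) y = ⨆ x ∈ S, L.transporter x y := by
  unfold transporter
  simp only [sSup_eq_iSup, map_iSup, iSup_inf_eq, (L.open_fst hp).dirIm_iSup]

theorem transporter_lres (a : G.G₀.unop) (x y : L.X.unop) :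
    L.transporter (invIm L.p a ⊓ x) y = invIm G.d a ⊓ L.transporter x y := by
  unfold transporter
  rw [map_inf, ← invIm_fst_d, inf_assoc, (L.open_fst hp).dirIm_invIm_inf]

variable (hG : G.IsOpenGroupoid)
include hG

/-- Both sides are the direct image along `(g, h, z) ↦ gh` of the conditions `g ∈ q`, `hz ∈ x`, `z ∈
y`. Beck–Chevalley is applied to the square of `act` against itself on the left and to the defining
square of the triples on the right. -/
theorem transporter_qact (q : G.G₁.unop) (x y : L.X.unop) :
    L.transporter (L.qact q x) y = G.translation.qact q (L.transporter x y) := by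
  have hW := isPullback_pullbackLocale G.snd L.fst
  have ha := L.open_act hG
  have hm : IsOpenLocaleMap G.m := G.translation.open_act hG
  have hf := L.open_fst hp
  have hT := isPullback_tripleMul_tripleAct hW
  have oM : IsOpenLocaleMap (tripleMul hW) := isOpen_fst hT ha
  have oG : IsOpenLocaleMap (pullbackFst G.snd L.fst) := isOpen_fst hW hf
  have e1 : ∀ t, invIm L.act (dirIm L.act t) = _ := fun t => (dirIm_fst_snd hT ha t).symm
  have e2 : ∀ t, invIm G.snd (dirIm L.fst t) = _ := fun t => (dirIm_fst_snd hW hf t).symm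
  change dirIm L.fst (invIm L.act (dirIm L.act (invIm L.fst q ⊓ invIm L.snd x)) ⊓ invIm L.snd y) =
    dirIm G.m (invIm G.fst q ⊓ invIm G.snd (dirIm L.fst (invIm L.act x ⊓ invIm L.snd y)))
  rw [e1, e2, ← oM.dirIm_inf_invIm, ← oG.dirIm_invIm_inf, ← oM.dirIm_comp hf,
    ← oG.dirIm_comp hm, tripleMul_fst hW]
  congr 1
  rw [map_inf, map_inf, ← invIm_comp, ← invIm_comp, ← invIm_comp, ← invIm_comp, ← invIm_comp,
    ← invIm_comp, tripleMul_snd, tripleAct_fst, tripleAct_snd, inf_assoc]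

omit hp in
theorem le_dirIm_act_snd (x : L.X.unop) : x ≤ dirIm L.act (invIm L.snd x) := by
  have h := (L.open_act hG).invIm_section_le L.unitSection_act (invIm L.snd x)
  rwa [← invIm_comp, unitSection, L.isPullback.lift_snd, invIm_id] at h

/-- As `d ∘ fst = p ∘ act`, Frobenius turns the support of `L.transporter x x` into `p_!(x ∧
act_!(snd^* x))`, and `x ≤ act_!(snd^* x)` because units act trivially. -/
theorem supp_le_transporter (x : L.X.unop) :
    invIm L.p (dirIm L.p x) ≤ L.qact (L.transporter x x) ⊤ := by
  have hf := L.open_fst hp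
  have ha := L.open_act hG
  rw [L.qact_top_right hG]
  refine OrderHomClass.mono (invIm L.p) ?_
  unfold transporter
  rw [← hf.dirIm_comp hG, ← L.act_p, ha.dirIm_comp hp, ha.dirIm_invIm_inf]
  exact hp.dirIm_mono (le_inf le_rfl (L.le_dirIm_act_snd hG x))

theorem supp_qact_le (q : G.G₁.unop) (x : L.X.unop) :
    dirIm L.p (L.qact q x) ≤ dirIm G.d q := by
  have hf := L.open_fst hp
  unfold qact
  rw [← (L.open_act hG).dirIm_comp hp, L.act_p, hf.dirIm_comp hG]
  exact hG.open_d.dirIm_mono (hf.dirIm_le_iff.2 inf_le_left)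

end LeftLocale

/-! ### Principal bundles -/

namespace PrincipalBundle

variable {M : Locale.{u}} (B : G.PrincipalBundle M)

theorem pairing_fstR : B.pairing ≫ B.fstR = B.act := B.isPullbackR.lift_fst _ _ _

theorem pairing_sndR : B.pairing ≫ B.sndR = B.snd := B.isPullbackR.lift_snd _ _ _

/-- The pairing isomorphism carries the projections of `X ×_M X` to `act` and `snd`, which reduces
the inner product to a construction on the `G`-locale alone. -/
theorem dirIm_theta (hp : IsOpenLocaleMap B.p) (x y : B.X.unop) :
    dirIm B.theta (invIm B.fstR x ⊓ invIm B.sndR y) = B.transporter x y := by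
  have h := isOpenLocaleMap_of_inverse (IsIso.inv_hom_id B.pairing) (IsIso.hom_inv_id B.pairing)
  rw [theta, h.dirIm_comp (B.open_fst hp),
    dirIm_of_inverse (IsIso.inv_hom_id B.pairing) (IsIso.hom_inv_id B.pairing), map_inf,
    ← invIm_comp, ← invIm_comp, pairing_fstR, pairing_sndR]
  rfl

theorem moduleOps_ip (hp : IsOpenLocaleMap B.p) (x y : B.X.unop) :
    B.moduleOps.ip x y = B.transporter x y := B.dirIm_theta hp x y

/-- The frame isomorphism `X ⊗_M X ≅ 𝒪(G) ⊗_{G₀} X` given by the pairing map. -/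
noncomputable def tensorIso :
    FrameTensor (invIm B.proj) (invIm B.proj) ≃o FrameTensor (invIm G.r) (invIm B.p) :=
  ((pullbackIso B.isPullbackR).symm.trans
    (orderIsoOfInverse (IsIso.hom_inv_id B.pairing) (IsIso.inv_hom_id B.pairing))).trans
    (pullbackIso B.isPullback)

variable (hG : G.IsOpenGroupoid)
include hG

theorem isModule : B.moduleOps.IsModule G.quantale where
  act_sSup_left := B.qact_sSup_left hG
  act_sSup_right := B.qact_sSup_right hG
  mul_act := B.qact_qact hG
  lres_sSup_left S x := by
    change invIm B.p (sSup S) ⊓ x = ⨆ a ∈ S, invIm B.p a ⊓ x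
    simp only [sSup_eq_iSup, map_iSup, iSup_inf_eq]
  lres_sSup_right a S := inf_sSup_eq
  lres_inf a b x := by
    change invIm B.p (a ⊓ b) ⊓ x = invIm B.p a ⊓ (invIm B.p b ⊓ x)
    rw [map_inf, inf_assoc]
  lres_top x := by
    change invIm B.p ⊤ ⊓ x = x
    rw [map_top, top_inf_eq]
  lres_act := B.qact_lres hG
  rres_act := B.qact_rres
  lres_inf_elem a x y := (inf_assoc _ _ _).symm

theorem isPreHilbert (hp : IsOpenLocaleMap B.p) : B.moduleOps.IsPreHilbert G.quantale where
  toIsModule := B.isModule hG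
  ip_act q x y := by
    rw [moduleOps_ip B hp, moduleOps_ip B hp]
    exact B.transporter_qact hp hG q x y
  ip_lres a x := by
    rw [moduleOps_ip B hp, moduleOps_ip B hp]
    exact (B.transporter_lres hp a x ⊤).symm
  ip_sSup S y := by
    simp only [moduleOps_ip B hp]
    exact B.transporter_sSup hp S y
  ip_star x y := by
    rw [moduleOps_ip B hp, moduleOps_ip B hp, quantale_star]
    exact B.transporter_comm hp x y

theorem isStablySupported (hB : B.IsFullyOpen) : B.moduleOps.IsStablySupported G.quantale where
  toIsPreHilbert := B.isPreHilbert hG hB.1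
  supp_mono _ _ h := hB.1.dirIm_mono h
  supp_top := hB.1.dirIm_top_of_surj hB.2
  supp_le x := by
    rw [moduleOps_ip B hB.1]
    exact inf_le_left.trans (B.supp_le_transporter hB.1 hG x)
  supp_self x := inf_eq_right.2 (hB.1.le_invIm_dirIm x)
  supp_act_le := B.supp_qact_le hB.1 hG

theorem actAdj_eq (x : B.X.unop) :
    B.moduleOps.actAdj G.quantale x = pullbackIso B.isPullback (invIm B.act x) :=
  (B.pullbackIso_act hG x).symm

theorem isQLocale (hB : B.IsFullyOpen) : B.moduleOps.IsQLocale G.quantale where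
  toIsStablySupported := B.isStablySupported hG hB
  q1 S := by
    simp only [actAdj_eq B hG]
    exact B.pullbackIso_act_sSup S
  q2 := B.iSup_unit hG

/-- Invariance of `proj` replaces `act` by `snd`; Frobenius and Beck–Chevalley then give `snd_!(q ⊗
x) = p^*(r_! q) ∧ x`, with `r_! q = d_!(q*)`. -/
theorem dirIm_proj_act (q : G.G₁.unop) (x : B.X.unop) :
    dirIm B.proj (B.qact q x) = dirIm B.proj (invIm B.p (dirIm G.d (invIm G.i q)) ⊓ x) := by
  have hs : IsOpenLocaleMap B.snd := isOpen_snd B.isPullback hG.open_r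
  unfold LeftLocale.qact
  rw [← (B.open_act hG).dirIm_comp B.proj_open, B.act_proj, hs.dirIm_comp B.proj_open,
    hs.dirIm_inf_invIm, dirIm_snd_fst B.isPullback hG.open_r, hG.dirIm_r]

/-- The pairing map pulls `x ⊗ y` back to `act^* x ∧ snd^* y`; expanding `act^* x` into rectangles
`q ⊗ z` and absorbing `y` into `z` gives the formula. -/
theorem tensorIso_tmul (x y : B.X.unop) :
    B.tensorIso (ftmul (invIm B.proj) (invIm B.proj) x y) =
      ⨆ (q : G.G₁.unop) (z : B.X.unop) (_ : B.qact q z ≤ x),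
        ftmul (invIm G.r) (invIm B.p) q (z ⊓ y) := by
  have h : (pullbackIso B.isPullbackR).symm (ftmul (invIm B.proj) (invIm B.proj) x y) =
      invIm B.fstR x ⊓ invIm B.sndR y := by
    rw [OrderIso.symm_apply_eq]
    exact (pullbackIso_tmul B.isPullbackR x y).symm
  change pullbackIso B.isPullback (invIm B.pairing ((pullbackIso B.isPullbackR).symm _)) = _
  rw [h, map_inf, ← invIm_comp, ← invIm_comp, pairing_fstR, pairing_sndR]
  have h2 : invIm B.act x ⊓ invIm B.snd y =
      ⨆ (q : G.G₁.unop) (z : B.X.unop) (_ : B.qact q z ≤ x),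
        invIm B.fst q ⊓ invIm B.snd (z ⊓ y) := by
    conv_lhs => rw [eq_iSup_of_isPullback B.isPullback (invIm B.act x)]
    simp only [iSup_inf_eq, inf_assoc, ← map_inf, ← B.qact_le_iff hG]
  rw [h2]
  simp only [OrderIso.map_iSup, pullbackIso_tmul]

theorem isPrincipalQLocale (hB : B.IsFullyOpen) :
    B.moduleOps.IsPrincipalQLocale G.quantale (invIm B.proj) where
  toIsQLocale := B.isQLocale hG hB
  p1_open := B.proj_open
  p1_top := IsOpenLocaleMap.dirIm_top_of_surj B.proj_open B.proj_surj
  p2 q x := by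
    rw [quantale_star]
    exact B.dirIm_proj_act hG q x
  p3 := ⟨B.tensorIso, B.tensorIso_tmul hG⟩

end PrincipalBundle

end LocalicGroupoid

theorem mainTheorem2 (G : LocalicGroupoid.{u}) (hG : G.IsOpenGroupoid) (M : Locale.{u})
    (B : G.PrincipalBundle M) (hB : B.IsFullyOpen) :
    G.quantale.IsGroupoidQuantale ∧
      B.moduleOps.IsPrincipalQLocale G.quantale (invIm B.proj) :=
  ⟨hG.isGroupoidQuantale, B.isPrincipalQLocale hG hB⟩
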